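/- Let $D$ be a division ring of characteristic $3$ that is finite-dimensional over its centre $C$, of degree $n$, i.e. $[D:C]=n^2$ (the case $D=C$ is allowed). Let $\delta$ be a derivation of $D$, put $F=\{a\in C \mid \delta(a)=0\}$, and suppose that $\delta|_C$, as an $F$-linear endomorphism of $C$, has minimum polynomial $g(t)=t^3-ct\in F[t]$. Let $D[t;\delta]$ be the differential polynomial ring, whose elements are the polynomials $\sum a_it^i$ with $a_i\in D$ and in which $ta=at+\delta(a)$ for $a\in D$. For $z\in D$ let $V_3(z)\in D$ be defined by $(t-z)^3=t^3-V_3(z)$ in $D[t;\delta]$. For $d\in D$ put $f(t)=t^3-ct-d\in D[t;\delta]$, and let $$(D,\delta,d)=D[t;\delta]/D[t;\delta]f(t)$$ denote the set of all $g\in D[t;\delta]$ of degree less than $3$ with the usual addition and the multiplication $g\circ h=gh \bmod_r f$, the remainder of $gh$ on right division by $f$ (that is, $gh=qf+(g\circ h)$ with $\deg (g\circ h)<3$). Then for every $d\in D$: 1. $(D,\delta,d)$ is a unital nonassociative (i.e. not necessarily associative) algebra over $F$ of dimension $9n^2$. 2. $(D,\delta,d)$ is a division algebra (it is nonzero, and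 all left and right multiplications by nonzero elements are bijective) if and only if $$V_3(z)-cz\neq d \quad\text{and}\quad V_3(z)-zc-d+\delta(c)\neq 0\qquad\text{for all } z\in D.$$ 3. If $g(\delta)=0$ on all of $D$, i.e. $\delta^3(x)=c\,\delta(x)$ for all $x\in D$ (which is automatic when $D=C$), then $(D,\delta,d)$ is associative if and only if $d\in F$. 4. The group $\mathrm{Aut}_F((D,\delta,d))$ of $F$-algebra automorphisms has a subgroup isomorphic to the additive group $\{\delta(u)/u \mid u\in C,\ u\neq 0\}$ of logarithmic derivatives. -/

import Mathlib

/-- A derivation of a (not necessarily commutative) ring: an additive map satisfying the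
Leibniz rule. -/
structure RingDerivation (D : Type*) [Ring D] extends D →+ D where
  leibniz' : ∀ a b : D, toFun (a * b) = a * toFun b + toFun a * b

namespace RingDerivation

variable {D : Type*}

instance instFunLike [Ring D] : FunLike (RingDerivation D) D D where
  coe δ := δ.toFun
  coe_injective := by
    rintro ⟨f, hf⟩ ⟨g, hg⟩ h
    congr
    exact DFunLike.coe_injective h

instance instAddMonoidHomClass [Ring D] : AddMonoidHomClass (RingDerivation D) D D where
  map_add δ := δ.map_add'
  map_zero δ := δ.map_zero'

theorem leibniz [Ring D] (δ : RingDerivation D) (a b : D) :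
    δ (a * b) = a * δ b + δ a * b := δ.leibniz' a b

theorem map_one_eq_zero [Ring D] (δ : RingDerivation D) : δ 1 = 0 := by
  have h := δ.leibniz 1 1
  simpa using h

/-- A derivation maps the centre to itself. -/
theorem map_mem_center [Ring D] (δ : RingDerivation D) {a : D} (ha : a ∈ Subring.center D) :
    δ a ∈ Subring.center D := by
  rw [Subring.mem_center_iff] at ha ⊢
  intro x
  have h := congrArg δ (ha x)
  rw [δ.leibniz, δ.leibniz, ha (δ x)] at h
  rw [add_comm] at h
  exact add_left_cancel h

variable [DivisionRing D]

/-- The field `F = C ∩ Const(δ)` of central constants, as a subfield of the centre `C` of `D`. -/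
def constField (δ : RingDerivation D) : Subfield (Subring.center D) where
  carrier := {a | δ (a : D) = 0}
  mul_mem' := by
    intro a b ha hb
    simp only [Set.mem_ofPred_eq] at ha hb ⊢
    simp [δ.leibniz, ha, hb]
  one_mem' := by simp [map_one_eq_zero]
  add_mem' := by
    intro a b ha hb
    simp only [Set.mem_ofPred_eq] at ha hb ⊢
    simp [ha, hb]
  zero_mem' := by simp
  neg_mem' := by
    intro a ha
    simp only [Set.mem_ofPred_eq] at ha ⊢
    simp [ha]
  inv_mem' := by
    intro a ha
    simp only [Set.mem_ofPred_eq] at ha ⊢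
    rcases eq_or_ne a 0 with rfl | h0
    · simp
    have h0' : (a : D) ≠ 0 := fun h => h0 (Subtype.ext h)
    have h1 : (a : D) * ((a⁻¹ : Subring.center D) : D) = 1 := by
      have := congrArg (Subtype.val) (mul_inv_cancel₀ h0)
      simpa using this
    have h2 := congrArg δ h1
    rw [δ.leibniz, ha, δ.map_one_eq_zero, zero_mul, add_zero] at h2
    exact (mul_eq_zero.mp h2).resolve_left h0'

/-- The restriction `δ|_C` of `δ` to the centre `C`, as an `F`-linear map. -/
def onCenter (δ : RingDerivation D) :
    Subring.center D →ₗ[δ.constField] Subring.center D where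
  toFun a := ⟨δ (a : D), δ.map_mem_center a.2⟩
  map_add' a b := by ext; simp
  map_smul' r a := by
    ext
    have hr : δ ((r : Subring.center D) : D) = 0 := r.2
    simp [Subfield.smul_def, δ.leibniz, hr]

/-- The additive group `{δ(u)/u | u ∈ C, u ≠ 0}` of logarithmic derivatives. -/
def logDerivatives (δ : RingDerivation D) : AddSubgroup (Subring.center D) where
  carrier := {a | ∃ u : Subring.center D, u ≠ 0 ∧ a = δ.onCenter u / u}
  add_mem' := by
    rintro a b ⟨u, hu, rfl⟩ ⟨v, hv, rfl⟩
    refine ⟨u * v, mul_ne_zero hu hv, ?_⟩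
    have h : δ.onCenter (u * v) = u * δ.onCenter v + δ.onCenter u * v := by
      ext; simp [onCenter, δ.leibniz]
    rw [h]
    field_simp
    ring
  zero_mem' := by
    refine ⟨1, one_ne_zero, ?_⟩
    have h : δ.onCenter 1 = 0 := by ext; simp [onCenter, map_one_eq_zero]
    simp [h]
  neg_mem' := by
    rintro a ⟨u, hu, rfl⟩
    refine ⟨u⁻¹, inv_ne_zero hu, ?_⟩
    have h : δ.onCenter (u * u⁻¹) = u * δ.onCenter u⁻¹ + δ.onCenter u * u⁻¹ := by
      ext; simp [onCenter, δ.leibniz]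
    have h1 : δ.onCenter 1 = 0 := by ext; simp [onCenter, map_one_eq_zero]
    rw [mul_inv_cancel₀ hu, h1] at h
    have h2 : δ.onCenter u⁻¹ = - (δ.onCenter u * u⁻¹) / u := by
      field_simp
      field_simp at h
      linear_combination -h
    rw [h2]
    field_simp

end RingDerivation

/-- The differential polynomial ring `D[t;δ]`. Its elements are the left polynomials
`∑ aᵢ tⁱ`, with termwise addition; the multiplication, determined by `t a = a t + δ(a)`, is
defined below. -/
def DiffPoly {D : Type*} [Ring D] (_δ : RingDerivation D) : Type _ := Polynomial D

namespace DiffPoly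

variable {D : Type*}

section ring

variable [Ring D] (δ : RingDerivation D)

noncomputable instance instAddCommGroup : AddCommGroup (DiffPoly δ) :=
  inferInstanceAs (AddCommGroup (Polynomial D))

/-- The underlying left polynomial (the family of coefficients). -/
noncomputable def toPoly {δ : RingDerivation D} : DiffPoly δ ≃+ Polynomial D := AddEquiv.refl _

/-- The constant polynomial `a`. -/
noncomputable def const (a : D) : DiffPoly δ := toPoly.symm (Polynomial.C a)

/-- The variable `t`. -/
noncomputable def t : DiffPoly δ := toPoly.symm Polynomial.X

/-- Left multiplication by `t`: `t · ∑ bⱼ tʲ = ∑ (bⱼ tʲ⁺¹ + δ(bⱼ) tʲ)`. -/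
noncomputable def tMul : AddMonoid.End (Polynomial D) where
  toFun q := Polynomial.X * q + q.sum fun j b => Polynomial.monomial j (δ b)
  map_zero' := by simp
  map_add' p q := by
    rw [Polynomial.sum_add_index] <;> simp [mul_add, add_assoc, add_left_comm]

/-- Left multiplication by `∑ aᵢ tⁱ`: `q ↦ ∑ aᵢ · tⁱ q`. -/
noncomputable def leftMul : Polynomial D →+ AddMonoid.End (Polynomial D) where
  toFun p := p.sum fun i a => AddMonoid.End.mulLeft (Polynomial.C a) * (tMul δ) ^ i
  map_zero' := by simp
  map_add' p q := by
    rw [Polynomial.sum_add_index]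
    · intro i; ext1 x; simp
    · intro i a b; ext1 x; simp [add_mul]

noncomputable instance instMul : Mul (DiffPoly δ) :=
  ⟨fun p q => toPoly.symm (leftMul δ (toPoly p) (toPoly q))⟩

noncomputable instance instOne : One (DiffPoly δ) := ⟨const δ 1⟩

theorem tMul_apply (q : Polynomial D) :
    tMul δ q = Polynomial.X * q + q.sum fun j b => Polynomial.monomial j (δ b) := rfl

theorem coeff_tMul_zero (q : Polynomial D) : (tMul δ q).coeff 0 = δ (q.coeff 0) := by
  simp only [tMul_apply, Polynomial.coeff_add,
    Polynomial.coeff_X_mul_zero, zero_add, Polynomial.sum_def, Polynomial.finsetSum_coeff,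
    Polynomial.coeff_monomial]
  rw [Finset.sum_ite_eq' q.support 0 (fun j => δ (q.coeff j))]
  split_ifs with h
  · rfl
  · simp [Polynomial.notMem_support_iff.mp h]

theorem coeff_tMul_succ (q : Polynomial D) (k : ℕ) :
    (tMul δ q).coeff (k + 1) = q.coeff k + δ (q.coeff (k + 1)) := by
  simp only [tMul_apply, Polynomial.coeff_add,
    Polynomial.coeff_X_mul, Polynomial.sum_def, Polynomial.finsetSum_coeff,
    Polynomial.coeff_monomial]
  rw [Finset.sum_ite_eq' q.support (k + 1) (fun j => δ (q.coeff j))]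
  split_ifs with h
  · rfl
  · simp [Polynomial.notMem_support_iff.mp h]

theorem tMul_C_mul (a : D) (q : Polynomial D) :
    tMul δ (Polynomial.C a * q) = Polynomial.C a * tMul δ q + Polynomial.C (δ a) * q := by
  ext k
  cases k with
  | zero => simp [coeff_tMul_zero, δ.leibniz]
  | succ k => simp [coeff_tMul_succ, δ.leibniz, mul_add, add_assoc]

theorem leftMul_monomial (i : ℕ) (a : D) (q : Polynomial D) :
    leftMul δ (Polynomial.monomial i a) q = Polynomial.C a * ((tMul δ) ^ i) q := by
  change (Polynomial.sum (Polynomial.monomial i a)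
    fun i a => AddMonoid.End.mulLeft (Polynomial.C a) * (tMul δ) ^ i) q = _
  rw [Polynomial.sum_monomial_index]
  · rfl
  · ext1 x; simp

theorem leftMul_add (p₁ p₂ q : Polynomial D) :
    leftMul δ (p₁ + p₂) q = leftMul δ p₁ q + leftMul δ p₂ q :=
  DFunLike.congr_fun ((leftMul δ).map_add p₁ p₂) q

theorem leftMul_C (a : D) (q : Polynomial D) :
    leftMul δ (Polynomial.C a) q = Polynomial.C a * q := by
  have h := leftMul_monomial δ 0 a q
  simpa using h

theorem leftMul_X (q : Polynomial D) : leftMul δ Polynomial.X q = tMul δ q := by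
  have h := leftMul_monomial δ 1 1 q
  simpa [Polynomial.monomial_one_one_eq_X] using h

theorem leftMul_C_mul (a : D) (p q : Polynomial D) :
    leftMul δ (Polynomial.C a * p) q = Polynomial.C a * leftMul δ p q := by
  induction p using Polynomial.induction_on' with
  | add p₁ p₂ h₁ h₂ => simp only [mul_add, leftMul_add, h₁, h₂]
  | monomial i b =>
    rw [Polynomial.C_mul_monomial, leftMul_monomial, leftMul_monomial, Polynomial.C_mul, mul_assoc]

theorem tMul_monomial (i : ℕ) (b : D) :
    tMul δ (Polynomial.monomial i b)
      = Polynomial.monomial (i + 1) b + Polynomial.monomial i (δ b) := by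
  ext k
  cases k with
  | zero => simp [coeff_tMul_zero, Polynomial.coeff_monomial, apply_ite δ]
  | succ k =>
    rw [coeff_tMul_succ]
    simp [Polynomial.coeff_monomial, apply_ite δ]

theorem leftMul_tMul (p q : Polynomial D) :
    leftMul δ (tMul δ p) q = tMul δ (leftMul δ p q) := by
  induction p using Polynomial.induction_on' with
  | add p₁ p₂ h₁ h₂ => rw [map_add, leftMul_add, h₁, h₂, leftMul_add, map_add]
  | monomial i b =>
    rw [tMul_monomial, leftMul_add, leftMul_monomial, leftMul_monomial,
      leftMul_monomial, tMul_C_mul, pow_succ']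
    rfl

theorem leftMul_tMul_pow (i : ℕ) (p q : Polynomial D) :
    leftMul δ (((tMul δ) ^ i) p) q = ((tMul δ) ^ i) (leftMul δ p q) := by
  induction i with
  | zero => rfl
  | succ i ih =>
    rw [pow_succ']
    change leftMul δ (tMul δ (((tMul δ) ^ i) p)) q = tMul δ (((tMul δ) ^ i) (leftMul δ p q))
    rw [leftMul_tMul, ih]

theorem leftMul_assoc (p q r : Polynomial D) :
    leftMul δ (leftMul δ p q) r = leftMul δ p (leftMul δ q r) := by
  induction p using Polynomial.induction_on' with
  | add p₁ p₂ h₁ h₂ => rw [leftMul_add, leftMul_add, h₁, h₂, leftMul_add]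
  | monomial i b =>
    rw [leftMul_monomial, leftMul_monomial, leftMul_C_mul, leftMul_tMul_pow]

theorem tMul_pow_one (i : ℕ) : ((tMul δ) ^ i) (1 : Polynomial D) = Polynomial.X ^ i := by
  induction i with
  | zero => simp
  | succ i ih =>
    rw [pow_succ']
    change tMul δ (((tMul δ) ^ i) 1) = _
    rw [ih, ← Polynomial.monomial_one_right_eq_X_pow, tMul_monomial, δ.map_one_eq_zero]
    simp [Polynomial.monomial_one_right_eq_X_pow]

theorem leftMul_one (p : Polynomial D) : leftMul δ p 1 = p := by
  induction p using Polynomial.induction_on' with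
  | add p₁ p₂ h₁ h₂ => rw [leftMul_add, h₁, h₂]
  | monomial i b => rw [leftMul_monomial, tMul_pow_one, Polynomial.C_mul_X_pow_eq_monomial]

noncomputable instance instRing : Ring (DiffPoly δ) :=
  { instAddCommGroup δ, instMul δ, instOne δ with
    left_distrib := fun p q r => (leftMul δ (toPoly p)).map_add (toPoly q) (toPoly r)
    right_distrib := fun p q r =>
      DFunLike.congr_fun ((leftMul δ).map_add (toPoly p) (toPoly q)) (toPoly r)
    zero_mul := fun p => DFunLike.congr_fun ((leftMul δ).map_zero) (toPoly p)
    mul_zero := fun p => (leftMul δ (toPoly p)).map_zero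
    mul_assoc := fun p q r => leftMul_assoc δ (toPoly p) (toPoly q) (toPoly r)
    one_mul := fun p => by
      change leftMul δ (Polynomial.C 1) (toPoly p) = p
      rw [leftMul_C, Polynomial.C_1, one_mul]
      rfl
    mul_one := fun p => by
      change leftMul δ (toPoly p) (Polynomial.C 1) = p
      rw [Polynomial.C_1, leftMul_one]
      rfl }

theorem toPoly_mul (p q : DiffPoly δ) :
    toPoly (p * q) = leftMul δ (toPoly p) (toPoly q) := rfl

theorem toPoly_const_mul (a : D) (q : DiffPoly δ) :
    toPoly (const δ a * q) = Polynomial.C a * toPoly q := leftMul_C δ a (toPoly q)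

theorem toPoly_t_pow (k : ℕ) : toPoly (t δ ^ k) = Polynomial.X ^ k := by
  induction k with
  | zero => exact Polynomial.C_1
  | succ k ih =>
    rw [pow_succ', toPoly_mul, ih]
    change leftMul δ Polynomial.X _ = _
    rw [leftMul_X, ← tMul_pow_one δ k, ← tMul_pow_one δ (k + 1), pow_succ']
    rfl

/-- The defining relation `t a = a t + δ(a)`. -/
theorem t_mul_const (a : D) : t δ * const δ a = const δ a * t δ + const δ (δ a) := by
  apply toPoly.injective
  rw [map_add, toPoly_const_mul, toPoly_mul]
  change leftMul δ Polynomial.X (Polynomial.C a) = Polynomial.C a * Polynomial.X + Polynomial.C (δ a)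
  rw [leftMul_X, ← mul_one (Polynomial.C a), tMul_C_mul]
  simp [← Polynomial.C_1, ← Polynomial.monomial_zero_left, tMul_monomial, δ.map_one_eq_zero]
  simp [Polynomial.monomial_one_one_eq_X]

theorem const_mul_const (a b : D) : const δ a * const δ b = const δ (a * b) := by
  apply toPoly.injective
  rw [toPoly_const_mul]
  exact Polynomial.C_mul.symm

theorem const_add (a b : D) : const δ (a + b) = const δ a + const δ b :=
  toPoly.injective Polynomial.C_add

theorem const_sub (a b : D) : const δ (a - b) = const δ a - const δ b :=
  toPoly.injective Polynomial.C_sub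

/-- The element `V_p(b) ∈ D` given by `(t - b)^p = t^p - V_p(b)` in `D[t;δ]`, for `D` of
characteristic `p`. -/
noncomputable def V (p : ℕ) (b : D) : D :=
  (toPoly (t δ ^ p - (t δ - const δ b) ^ p)).coeff 0

/-- `(t - b)³ = t³ - (b³ + δ²(b) + bδ(b) - δ(b)b)` in characteristic 3. -/
theorem t_sub_const_pow_three [CharP D 3] (b : D) :
    (t δ - const δ b) ^ 3
      = t δ ^ 3 - const δ (b ^ 3 + δ (δ b) + b * δ b - δ b * b) := by
  have h3D : ((3 : ℕ) : D) = 0 := CharP.cast_eq_zero D 3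
  have h3 : (3 : DiffPoly δ) = 0 := by
    have : (3 : DiffPoly δ) = const δ ((3 : ℕ) : D) := by
      have h1 : (1 : DiffPoly δ) = const δ 1 := rfl
      have e : (3 : DiffPoly δ) = 1 + 1 + 1 := by norm_num
      rw [e, h1, ← const_add, ← const_add]
      norm_num
    rw [this, h3D]
    exact toPoly.injective Polynomial.C_0
  have r := t_mul_const δ
  have e1 : t δ * (t δ * const δ b) = const δ b * (t δ * t δ) + const δ (δ b) * t δ
      + const δ (δ b) * t δ + const δ (δ (δ b)) := by
    rw [r, mul_add, ← mul_assoc, r, r, add_mul, mul_assoc]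
    abel
  have e2 : t δ * const δ b * const δ b
      = const δ (b * b) * t δ + const δ (b * δ b) + const δ (δ b * b) := by
    rw [r, add_mul, mul_assoc, r, mul_add, ← mul_assoc]
    simp only [const_mul_const]
  have e : (t δ - const δ b) ^ 3 = t δ ^ 3 - (t δ * (t δ * const δ b)
      + t δ * const δ b * t δ + const δ b * (t δ * t δ))
      + (t δ * const δ b * const δ b + const δ b * (t δ * const δ b)
      + const δ b * const δ b * t δ) - const δ b * const δ b * const δ b := by
    noncomm_ring
  rw [e, e1, e2, r]
  simp only [const_mul_const, const_add, const_sub, add_mul, mul_add, ← mul_assoc, pow_succ,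
    pow_zero, one_mul]
  have k1 : ∀ x : DiffPoly δ, x + x + x = 0 := fun x => by
    have : x + x + x = 3 * x := by noncomm_ring
    rw [this, h3, zero_mul]
  have k3 : ∀ x y w : DiffPoly δ, x + x + x = 0 → y = w + (x + x + x) → y = w := by
    intro x y w h h'
    rw [h', h, add_zero]
  refine k3 _ _ _ (k1 (-(const δ b * t δ * t δ) - const δ (δ b) * t δ
    + const δ (b * b) * t δ)) ?_
  rw [eq_comm, ← sub_eq_zero]
  refine Eq.trans ?_ (neg_eq_zero.mpr (k1 (const δ (b * δ b))))
  abel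

theorem V_three [CharP D 3] (b : D) :
    V δ 3 b = b ^ 3 + δ (δ b) + b * δ b - δ b * b := by
  rw [V, t_sub_const_pow_three, sub_sub_cancel]
  exact Polynomial.coeff_C_zero

theorem sub_eq (p q : DiffPoly δ) : toPoly (p - q) = toPoly p - toPoly q := map_sub toPoly p q

end ring

/-! Right division with remainder. -/
section division

variable [DivisionRing D] {δ : RingDerivation D}

/-- `f` has leading coefficient 1. -/
def Monic (f : DiffPoly δ) : Prop := (toPoly f).Monic

/-- The degree of `f`. -/
noncomputable def natDegree (f : DiffPoly δ) : ℕ := (toPoly f).natDegree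

theorem natDegree_tMul_le (q : Polynomial D) : (tMul δ q).natDegree ≤ q.natDegree + 1 := by
  rw [Polynomial.natDegree_le_iff_coeff_eq_zero]
  intro k hk
  obtain ⟨k, rfl⟩ : ∃ j, k = j + 1 := ⟨k - 1, by omega⟩
  rw [coeff_tMul_succ, Polynomial.coeff_eq_zero_of_natDegree_lt (by omega),
    Polynomial.coeff_eq_zero_of_natDegree_lt (by omega)]
  simp

theorem monic_tMul_pow {f : Polynomial D} (hf : f.Monic) (k : ℕ) :
    (((tMul δ) ^ k) f).Monic ∧ (((tMul δ) ^ k) f).natDegree = f.natDegree + k := by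
  induction k with
  | zero => exact ⟨hf, rfl⟩
  | succ k ih =>
    obtain ⟨h1, h2⟩ := ih
    rw [pow_succ']
    change (tMul δ (((tMul δ) ^ k) f)).Monic ∧ (tMul δ (((tMul δ) ^ k) f)).natDegree = _
    generalize ((tMul δ) ^ k) f = g at h1 h2
    have hle := natDegree_tMul_le (δ := δ) g
    have hc : (tMul δ g).coeff (g.natDegree + 1) = 1 := by
      rw [coeff_tMul_succ, h1.coeff_natDegree,
        Polynomial.coeff_eq_zero_of_natDegree_lt (Nat.lt_succ_self _)]
      simp
    refine ⟨Polynomial.monic_of_natDegree_le_of_coeff_eq_one _ hle hc, ?_⟩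
    rw [← add_assoc, ← h2]
    refine le_antisymm hle (Polynomial.le_natDegree_of_ne_zero ?_)
    rw [hc]
    exact one_ne_zero

theorem coeff_leftMul_top (q : Polynomial D) {f : Polynomial D} (hf : f.Monic) :
    (leftMul δ q f).coeff (f.natDegree + q.natDegree) = q.leadingCoeff := by
  have h : ∀ s : ℕ, ∀ q : Polynomial D, q.natDegree ≤ s →
      (leftMul δ q f).coeff (f.natDegree + s) = q.coeff s := by
    intro s
    induction s with
    | zero =>
      intro q hq
      rw [Polynomial.eq_C_of_natDegree_le_zero hq, leftMul_C]
      simp [hf.coeff_natDegree]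
    | succ s ih =>
      intro q hq
      have hlow : ∀ q : Polynomial D, q.natDegree ≤ s →
          (leftMul δ q f).coeff (f.natDegree + (s + 1)) = 0 := by
        intro q _
        have e : leftMul δ q f = ∑ i ∈ Finset.range (s + 1),
            leftMul δ (Polynomial.monomial i (q.coeff i)) f := by
          conv_lhs => rw [q.as_sum_range' (s + 1) (by omega), map_sum]
          exact AddMonoidHom.finsetSum_apply _ _ _
        rw [e, Polynomial.finsetSum_coeff]
        refine Finset.sum_eq_zero fun i hi => ?_
        have hi' := Finset.mem_range.mp hi
        have hz : ((tMul δ ^ i) f).coeff (f.natDegree + (s + 1)) = 0 := by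
          apply Polynomial.coeff_eq_zero_of_natDegree_lt
          rw [(monic_tMul_pow hf i).2]
          omega
        rw [leftMul_monomial, Polynomial.coeff_C_mul, hz, mul_zero]
      have hdec : q = (q - Polynomial.monomial (s + 1) (q.coeff (s + 1)))
          + Polynomial.monomial (s + 1) (q.coeff (s + 1)) := by abel
      have hd : (q - Polynomial.monomial (s + 1) (q.coeff (s + 1))).natDegree ≤ s := by
        rw [Polynomial.natDegree_le_iff_coeff_eq_zero]
        intro k hk
        rw [Polynomial.coeff_sub, Polynomial.coeff_monomial]
        split_ifs with h
        · rw [h, sub_self]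
        · rw [Polynomial.coeff_eq_zero_of_natDegree_lt (by omega), sub_zero]
      have hm := monic_tMul_pow (δ := δ) hf (s + 1)
      rw [hdec, leftMul_add, Polynomial.coeff_add, hlow _ hd, leftMul_monomial,
        Polynomial.coeff_C_mul, ← hm.2, hm.1.coeff_natDegree]
      simp
  exact h q.natDegree q le_rfl

/-- Right division: for monic `f` every `g` is uniquely `q f + r` with `deg r < deg f`. -/
theorem existsUnique_remainder {f : DiffPoly δ} (hf : f.Monic) (g : DiffPoly δ) :
    ∃! r : Polynomial.degreeLT D f.natDegree, ∃ q : DiffPoly δ, g = q * f + toPoly.symm r := by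
  have hex : ∀ N : ℕ, ∀ g : DiffPoly δ, (toPoly g).degree < (N : WithBot ℕ) →
      ∃ r : Polynomial.degreeLT D f.natDegree, ∃ q : DiffPoly δ, g = q * f + toPoly.symm r := by
    intro N
    induction N with
    | zero =>
      intro g hg
      refine ⟨⟨toPoly g, Polynomial.mem_degreeLT.mpr (hg.trans_le ?_)⟩, 0, ?_⟩
      · exact_mod_cast Nat.zero_le _
      · simp
    | succ N ih =>
      intro g hg
      rcases lt_or_ge N f.natDegree with hN | hN
      · refine ⟨⟨toPoly g, Polynomial.mem_degreeLT.mpr (hg.trans_le ?_)⟩, 0, ?_⟩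
        · exact_mod_cast hN
        · simp
      · obtain ⟨k, rfl⟩ := Nat.exists_eq_add_of_le hN
        have hm := monic_tMul_pow (δ := δ) hf k
        let a := (toPoly g).coeff (f.natDegree + k)
        let u : DiffPoly δ := toPoly.symm (Polynomial.monomial k a)
        have hu : toPoly (u * f) = Polynomial.C a * ((tMul δ) ^ k) (toPoly f) :=
          leftMul_monomial δ k a (toPoly f)
        obtain ⟨r, q, h⟩ := ih (g - u * f) (by
          rw [Polynomial.degree_lt_iff_coeff_zero]
          intro j hj
          rw [sub_eq, hu, Polynomial.coeff_sub, Polynomial.coeff_C_mul]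
          rcases hj.eq_or_lt with h | h
          · have h' : j = (((tMul δ) ^ k) (toPoly f)).natDegree := by rw [hm.2, ← h]; rfl
            rw [h', hm.1.coeff_natDegree, ← h', ← h, mul_one, sub_self]
          · rw [Polynomial.coeff_eq_zero_of_degree_lt, Polynomial.coeff_eq_zero_of_natDegree_lt,
              mul_zero, sub_zero]
            · rw [hm.2]; exact h
            · refine hg.trans_le ?_
              exact_mod_cast h)
        exact ⟨r, q + u, by rw [add_mul, add_right_comm, ← h, sub_add_cancel]⟩
  obtain ⟨r, q, h⟩ := hex ((toPoly g).natDegree + 1) g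
    (Polynomial.degree_le_natDegree.trans_lt (by exact_mod_cast Nat.lt_succ_self _))
  refine ⟨r, ⟨q, h⟩, ?_⟩
  rintro r' ⟨q', h'⟩
  have e : (q - q') * f = toPoly.symm ((r' - r : Polynomial.degreeLT D f.natDegree) : Polynomial D) := by
    have e1 : q * f + toPoly.symm r = q' * f + toPoly.symm (r' : Polynomial D) := by
      rw [← h, ← h']
    rw [sub_mul, Submodule.coe_sub, map_sub, sub_eq_sub_iff_add_eq_add, e1, add_comm]
  have hdeg := Polynomial.mem_degreeLT.mp (r' - r).2
  have e2 : leftMul δ (toPoly (q - q')) (toPoly f)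
      = ((r' - r : Polynomial.degreeLT D f.natDegree) : Polynomial D) := e
  have hq : toPoly (q - q') = 0 := by
    rw [← Polynomial.leadingCoeff_eq_zero, ← coeff_leftMul_top (δ := δ) _ hf, e2]
    refine Polynomial.coeff_eq_zero_of_degree_lt (hdeg.trans_le ?_)
    exact_mod_cast Nat.le_add_right _ _
  rw [hq, map_zero] at e2
  exact sub_eq_zero.mp (Subtype.ext e2.symm)

/-- `g mod_r f`, the remainder of `g` on right division by the monic polynomial `f`. -/
noncomputable def modR {f : DiffPoly δ} (hf : f.Monic) (g : DiffPoly δ) :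
    Polynomial.degreeLT D f.natDegree :=
  (existsUnique_remainder hf g).choose

theorem modR_spec {f : DiffPoly δ} (hf : f.Monic) (g : DiffPoly δ) :
    ∃ q : DiffPoly δ, g = q * f + toPoly.symm (modR hf g) :=
  (existsUnique_remainder hf g).choose_spec.1

theorem modR_eq {f : DiffPoly δ} (hf : f.Monic) {g q : DiffPoly δ} {r : Polynomial.degreeLT D f.natDegree}
    (h : g = q * f + toPoly.symm r) : modR hf g = r :=
  ((existsUnique_remainder hf g).choose_spec.2 r ⟨q, h⟩).symm

theorem modR_add {f : DiffPoly δ} (hf : f.Monic) (g h : DiffPoly δ) :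
    modR hf (g + h) = modR hf g + modR hf h := by
  obtain ⟨q, hq⟩ := modR_spec hf g
  obtain ⟨q', hq'⟩ := modR_spec hf h
  refine modR_eq hf (q := q + q') ?_
  rw [Submodule.coe_add, map_add, add_mul]
  nth_rewrite 1 [hq, hq']
  abel

theorem modR_const_mul {f : DiffPoly δ} (hf : f.Monic) (a : D) (g : DiffPoly δ) :
    modR hf (const δ a * g) = a • modR hf g := by
  obtain ⟨q, hq⟩ := modR_spec hf g
  refine modR_eq hf (q := const δ a * q) ?_
  have e : toPoly.symm ((a • modR hf g : Polynomial.degreeLT D f.natDegree) : Polynomial D)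
      = const δ a * toPoly.symm (modR hf g : Polynomial D) := by
    apply toPoly.injective
    rw [toPoly_const_mul, Submodule.coe_smul, Polynomial.smul_eq_C_mul]
    rfl
  rw [e, mul_assoc, ← mul_add, ← hq]

theorem modR_self {f : DiffPoly δ} (hf : f.Monic) (r : Polynomial.degreeLT D f.natDegree) :
    modR hf (toPoly.symm r) = r := modR_eq hf (q := 0) (by simp)

/-- A central constant is a central element of `D[t;δ]`. -/
theorem const_comm (a : δ.constField) (g : DiffPoly δ) :
    g * const δ ((a : Subring.center D) : D) = const δ ((a : Subring.center D) : D) * g := by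
  have ha : δ ((a : Subring.center D) : D) = 0 := a.2
  have hc := Subring.mem_center_iff.mp (a : Subring.center D).2
  generalize ((a : Subring.center D) : D) = b at ha hc
  have ht : ∀ k, (tMul δ ^ k) (Polynomial.C b) = Polynomial.C b * Polynomial.X ^ k := by
    intro k
    induction k with
    | zero => simp
    | succ k ih =>
      rw [pow_succ']
      change tMul δ ((tMul δ ^ k) (Polynomial.C b)) = _
      rw [ih, tMul_C_mul, ha, ← tMul_pow_one δ k, ← tMul_pow_one δ (k + 1), pow_succ']
      simp
  apply toPoly.injective
  rw [toPoly_const_mul, toPoly_mul]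
  change leftMul δ (toPoly g) (Polynomial.C b) = _
  induction toPoly g using Polynomial.induction_on' with
  | add p₁ p₂ h₁ h₂ => rw [leftMul_add, h₁, h₂, mul_add]
  | monomial i x =>
    rw [leftMul_monomial, ht, ← mul_assoc, ← Polynomial.C_mul, hc,
      Polynomial.C_mul_X_pow_eq_monomial, Polynomial.C_mul_monomial]

end division
end DiffPoly

section petit

open DiffPoly

/-- The Petit algebra `S_f = D[t;δ]/D[t;δ]f` of a monic `f ∈ D[t;δ]` of degree `m`: the
differential polynomials of degree less than `m` with the multiplication
`g ∘ h = gh mod_r f`. -/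
def PetitAlgebra {D : Type*} [DivisionRing D] {δ : RingDerivation D} (f : DiffPoly δ)
    (_hf : f.Monic) : Type _ := Polynomial.degreeLT D f.natDegree

namespace PetitAlgebra

variable {D : Type*} [DivisionRing D] {δ : RingDerivation D} {f : DiffPoly δ} {hf : f.Monic}

noncomputable instance instAddCommGroup : AddCommGroup (PetitAlgebra f hf) :=
  inferInstanceAs (AddCommGroup (Polynomial.degreeLT D f.natDegree))

noncomputable instance instModule : Module D (PetitAlgebra f hf) :=
  inferInstanceAs (Module D (Polynomial.degreeLT D f.natDegree))

/-- The scalar multiplication of `S_f` by the field `F` of central constants: `a • g = a g`. -/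
noncomputable instance instModuleConst : Module δ.constField (PetitAlgebra f hf) :=
  Module.compHom (PetitAlgebra f hf)
    ((Subring.center D).subtype.comp δ.constField.subtype)

/-- The polynomial of degree less than `m` that an element of `S_f` is. -/
noncomputable def lift : PetitAlgebra f hf →+ DiffPoly δ where
  toFun g := toPoly.symm (show Polynomial.degreeLT D f.natDegree from g).1
  map_zero' := rfl
  map_add' _ _ := rfl

/-- `g ↦ g mod_r f`. -/
noncomputable def proj (hf : f.Monic) : DiffPoly δ →+ PetitAlgebra f hf where
  toFun := modR hf
  map_zero' := by
    have h := modR_add hf 0 0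
    rw [add_zero] at h
    exact left_eq_add.mp h
  map_add' := modR_add hf

theorem proj_lift (g : PetitAlgebra f hf) : proj hf (lift g) = g := modR_self hf g

theorem proj_mul_right (p q : DiffPoly δ) : proj hf (p * lift (proj hf q)) = proj hf (p * q) := by
  obtain ⟨u, hu⟩ := modR_spec hf q
  obtain ⟨v, hv⟩ := modR_spec hf (p * lift (proj hf q))
  refine (modR_eq hf (q := p * u + v) ?_).symm
  have hu' : q = u * f + lift (proj hf q) := hu
  nth_rewrite 1 [hu']
  rw [mul_add, add_mul, mul_assoc, add_assoc]
  exact congrArg _ hv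

noncomputable instance instMul : Mul (PetitAlgebra f hf) :=
  ⟨fun g h => proj hf (lift g * lift h)⟩

noncomputable instance instOne : One (PetitAlgebra f hf) := ⟨proj hf 1⟩

theorem mul_def (g h : PetitAlgebra f hf) : g * h = proj hf (lift g * lift h) := rfl

theorem one_def : (1 : PetitAlgebra f hf) = proj hf 1 := rfl

noncomputable instance instNonAssocRing : NonAssocRing (PetitAlgebra f hf) :=
  { instAddCommGroup, instMul, instOne with
    left_distrib := fun a b c => by
      change proj hf (lift a * lift (b + c)) = proj hf (lift a * lift b) + proj hf (lift a * lift c)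
      rw [map_add, mul_add, map_add]
    right_distrib := fun a b c => by
      change proj hf (lift (a + b) * lift c) = proj hf (lift a * lift c) + proj hf (lift b * lift c)
      rw [map_add, add_mul, map_add]
    zero_mul := fun a => by
      change proj hf (lift 0 * lift a) = 0
      rw [map_zero, zero_mul, map_zero]
    mul_zero := fun a => by
      change proj hf (lift a * lift 0) = 0
      rw [map_zero, mul_zero, map_zero]
    mul_one := fun a => by
      change proj hf (lift a * lift (proj hf 1)) = a
      rw [proj_mul_right, mul_one, proj_lift]
    one_mul := fun a => by
      change proj hf (lift (proj hf 1) * lift a) = a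
      rcases Nat.eq_zero_or_pos f.natDegree with h0 | h0
      · have hs : ∀ x : Polynomial.degreeLT D f.natDegree, (x : Polynomial D) = 0 := fun x => by
          have hx := Polynomial.mem_degreeLT.mp x.2
          have hx' : (x : Polynomial D).degree < ((0 : ℕ) : WithBot ℕ) :=
            hx.trans_le (by exact_mod_cast h0.le)
          exact Polynomial.degree_eq_bot.mp (Nat.WithBot.lt_zero_iff.mp hx')
        exact Subtype.ext ((hs _).trans (hs a).symm)
      · have h1 : lift (proj hf (1 : DiffPoly δ)) = 1 := by
          have hm : (1 : Polynomial D) ∈ Polynomial.degreeLT D f.natDegree :=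
            Polynomial.mem_degreeLT.mpr (Polynomial.degree_one_le.trans_lt (by exact_mod_cast h0))
          have hone : (1 : DiffPoly δ) = toPoly.symm 1 := congrArg toPoly.symm Polynomial.C_1
          have := modR_self hf ⟨1, hm⟩
          rw [hone]
          exact congrArg (fun x : Polynomial.degreeLT D f.natDegree => toPoly.symm x.1) this
        rw [h1, one_mul, proj_lift] }

theorem smul_def (a : δ.constField) (g : PetitAlgebra f hf) :
    a • g = proj hf (const δ ((a : Subring.center D) : D) * lift g) := by
  refine Eq.trans ?_ (modR_const_mul hf ((a : Subring.center D) : D) (lift g)).symm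
  exact congrArg (((a : Subring.center D) : D) • ·) (proj_lift g).symm

theorem lift_smul (a : δ.constField) (g : PetitAlgebra f hf) :
    lift (a • g) = const δ ((a : Subring.center D) : D) * lift g := by
  apply toPoly.injective
  rw [toPoly_const_mul, ← Polynomial.smul_eq_C_mul]
  rfl

instance instIsScalarTower :
    IsScalarTower δ.constField (PetitAlgebra f hf) (PetitAlgebra f hf) where
  smul_assoc a x y := by
    rw [smul_eq_mul, smul_eq_mul, smul_def a (x * y), mul_def, mul_def, proj_mul_right, lift_smul,
      mul_assoc]

instance instSMulCommClass :
    SMulCommClass δ.constField (PetitAlgebra f hf) (PetitAlgebra f hf) where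
  smul_comm a x y := by
    rw [smul_eq_mul, smul_eq_mul, smul_def a (x * y), mul_def, mul_def, proj_mul_right, lift_smul,
      ← mul_assoc, ← mul_assoc, const_comm]

end PetitAlgebra

/-- A nonassociative ring `A ≠ 0` is a division algebra if for every `a ≠ 0` the left and right
multiplications by `a` are bijective. -/
def IsNonassocDivision (A : Type*) [NonAssocRing A] : Prop :=
  Nontrivial A ∧ ∀ a : A, a ≠ 0 →
    Function.Bijective (fun x : A => a * x) ∧ Function.Bijective (fun x : A => x * a)

/-- The automorphism group `Aut_F(A)` of a nonassociative `F`-algebra `A`: the ring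
automorphisms of `A` that are `F`-linear. -/
def nonassocAut (F A : Type*) [Field F] [NonAssocRing A] [Module F A] : Subgroup (RingAut A) where
  carrier := {φ | ∀ (a : F) (x : A), φ (a • x) = a • φ x}
  mul_mem' := by
    intro φ ψ hφ hψ a x
    change φ (ψ (a • x)) = a • φ (ψ x)
    rw [hψ, hφ]
  one_mem' := fun _ _ => rfl
  inv_mem' := by
    intro φ hφ a x
    apply φ.injective
    rw [hφ]
    change φ (φ.symm (a • x)) = a • φ (φ.symm x)
    rw [φ.apply_symm_apply, φ.apply_symm_apply]

/-- The polynomial `f = t³ - c t - d ∈ D[t;δ]`. -/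
noncomputable def cubicPoly {D : Type*} [DivisionRing D] (δ : RingDerivation D) (c d : D) :
    DiffPoly δ :=
  t δ ^ 3 - const δ c * t δ - const δ d

theorem cubicPoly_monic {D : Type*} [DivisionRing D] (δ : RingDerivation D) (c d : D) :
    (cubicPoly δ c d).Monic := by
  have h : toPoly (cubicPoly δ c d)
      = Polynomial.X ^ 3 - (Polynomial.C c * Polynomial.X + Polynomial.C d) := by
    rw [cubicPoly, DiffPoly.sub_eq, DiffPoly.sub_eq, toPoly_t_pow, toPoly_const_mul, sub_sub]
    rfl
  change (toPoly (cubicPoly δ c d)).Monic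
  rw [h]
  have hd : (Polynomial.C c * Polynomial.X + Polynomial.C d).degree < ((3 : ℕ) : WithBot ℕ) :=
    Polynomial.degree_linear_le.trans_lt (by exact_mod_cast (by norm_num : 1 < 3))
  exact Polynomial.monic_X_pow_sub hd

/-- The generalized differential algebra `(D, δ, d) = D[t;δ]/D[t;δ]f` with
`f = t³ - c t - d`. -/
abbrev GenDiffAlgebra {D : Type*} [DivisionRing D] (δ : RingDerivation D) (c d : D) : Type _ :=
  PetitAlgebra (cubicPoly δ c d) (cubicPoly_monic δ c d)

end petit

/-!
Left ideals of `D[t;δ]` are principal, so `D[t;δ]f` is a maximal left ideal when `f` is irreducible.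
If moreover `gh ∈ D[t;δ]f` and `h ∉ D[t;δ]f`, then right multiplication by `h` maps the polynomials
of degree less than `deg g` onto `D[t;δ]/D[t;δ]f`, whence `deg f ≤ deg g`: thus `S_f` has no zero
divisors, and being finite-dimensional it is a division algebra. A cubic `f` is reducible exactly
when it has a linear left or right factor, and the remainders of `t³ - ct - d` on division by
`t - z` are `V₃(z) - zc - d + δ(c)` on the left and `V₃(z) - cz - d` on the right.

Comparing the two ways to multiply `t^(m-1)`, `t` and `p` modulo `f`, where `m = deg f`, shows that
associativity of `S_f` forces `fp ∈ D[t;δ]f`; so `S_f` is associative exactly when `D[t;δ]f` is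
two-sided.

In characteristic `3` one has `t³a = at³ + δ³(a)`, so conjugation by a central unit `u` fixes `f`
and induces an automorphism of `S_f`. This automorphism is trivial exactly when `δ(u) = 0`, which is
also the kernel of `u ↦ δ(u)/u`.

Finally `[C:F] = 3` because, as in Artin's theorem for fixed fields, the functionals
`φ ↦ φ(y)`, for `y` running over an `F`-independent subset of `C`, are `C`-independent on `F[δ|_C]`,
whose dimension is the degree `3` of the minimum polynomial.
-/

section DerivationOfField

variable {F K ι : Type*} [Field F] [Field K] [Algebra F K] {D : Derivation F K K}
  {S : Subalgebra F (Module.End F K)} {y : ι → K}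

theorem sum_derivation_mul_apply_eq_zero (hS : (D : Module.End F K) ∈ S) {s : Finset ι}
    {b : ι → K} (hb : ∀ φ ∈ S, ∑ i ∈ s, b i * φ (y i) = 0) {φ : Module.End F K} (hφ : φ ∈ S) :
    ∑ i ∈ s, D (b i) * φ (y i) = 0 := by
  have hDφ : ∑ i ∈ s, b i * D (φ (y i)) = 0 := hb _ (S.mul_mem hS hφ)
  simpa [Finset.sum_add_distrib, hDφ, mul_comm] using congrArg D (hb φ hφ)

theorem forall_eq_zero_of_sum_mul_apply_eq_zero (hD : ∀ x, D x = 0 → x ∈ (algebraMap F K).range)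
    (hS : (D : Module.End F K) ∈ S) (hy : LinearIndependent F y) {s : Finset ι} {b : ι → K}
    (hb : ∀ φ ∈ S, ∑ i ∈ s, b i * φ (y i) = 0) : ∀ i ∈ s, b i = 0 := by
  classical
  induction s using Finset.induction_on generalizing b with
  | empty => simp
  | insert j s hj ih =>
    suffices hbj : b j = 0 from Finset.forall_mem_insert _ _ _ |>.mpr
      ⟨hbj, ih fun φ hφ ↦ by simpa [Finset.sum_insert hj, hbj] using hb φ hφ⟩
    by_contra hbj
    have normalised : ∀ φ ∈ S, ∑ i ∈ insert j s, b i / b j * φ (y i) = 0 := fun φ hφ ↦ by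
      simp only [div_mul_eq_mul_div, ← Finset.sum_div, hb φ hφ, zero_div]
    -- Artin's trick: the coefficient `1` at `j` has derivative `0`.
    have constant : ∀ i ∈ insert j s, D (b i / b j) = 0 := by
      have hDj : D (b j / b j) = 0 := by rw [div_self hbj, D.map_one_eq_zero]
      refine Finset.forall_mem_insert _ _ _ |>.mpr ⟨hDj, ih fun φ hφ ↦ ?_⟩
      simpa only [Finset.sum_insert hj, hDj, zero_mul, zero_add] using
        sum_derivation_mul_apply_eq_zero hS normalised hφ
    choose! c hc using fun i hi ↦ hD _ (constant i hi)
    have hcj : c j = 0 := by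
      refine linearIndependent_iff'.mp hy _ c ?_ j (Finset.mem_insert_self j s)
      rw [← normalised 1 S.one_mem]
      exact Finset.sum_congr rfl fun i hi ↦ by rw [Algebra.smul_def, hc i hi, Module.End.one_apply]
    simpa [hcj, div_self hbj] using hc j (Finset.mem_insert_self j s)

theorem rank_le_finrank_of_derivation_mem (hD : ∀ x, D x = 0 → x ∈ (algebraMap F K).range)
    (hS : (D : Module.End F K) ∈ S) [Module.Finite F S] :
    Module.rank F K ≤ Module.finrank F S := by
  have := Module.Free.of_divisionRing F S
  have := Module.Finite.linearMap F K S K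
  refine rank_le fun s hs ↦ ?_
  have eval_independent : LinearIndependent K fun x : s ↦
      (LinearMap.applyₗ (R := F) (M₂ := K) (x : K)).comp S.val.toLinearMap :=
    linearIndependent_iff'.mpr fun s' b hb ↦
      forall_eq_zero_of_sum_mul_apply_eq_zero hD hS hs fun φ hφ ↦ by
        simpa using LinearMap.congr_fun hb ⟨φ, hφ⟩
  simpa [Module.finrank_linearMap_self F K S] using eval_independent.fintype_card_le_finrank

theorem finrank_adjoin_singleton_le_natDegree_minpoly {A : Type*} [Ring A] [Algebra F A] {a : A}
    (ha : IsIntegral F a) : Module.finrank F (Algebra.adjoin F {a}) ≤ (minpoly F a).natDegree := by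
  classical
  have hspan := Submodule.span_range_natDegree_eq_adjoin (minpoly.monic ha) (minpoly.aeval F a)
  have hcard := finrank_span_finset_le_card (R := F)
    ((Finset.range (minpoly F a).natDegree).image fun i ↦ a ^ i)
  rw [Set.finrank, hspan] at hcard
  exact hcard.trans (Finset.card_image_le.trans_eq (Finset.card_range _))

theorem finrank_eq_natDegree_minpoly_derivation
    (hD : ∀ x, D x = 0 → x ∈ (algebraMap F K).range) :
    Module.finrank F K = (minpoly F (D : Module.End F K)).natDegree := by
  by_cases hint : IsIntegral F (D : Module.End F K)
  · have : Module.Finite F (Algebra.adjoin F {(D : Module.End F K)}) :=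
      Module.Finite.iff_fg.mpr hint.fg_adjoin_singleton
    have hrank := rank_le_finrank_of_derivation_mem hD
      (Algebra.self_mem_adjoin_singleton F (D : Module.End F K))
    have : FiniteDimensional F K :=
      Module.rank_lt_aleph0_iff.mp (hrank.trans_lt Cardinal.natCast_lt_aleph0)
    refine le_antisymm ?_ ?_
    · rw [← Module.finrank_eq_rank, Nat.cast_le] at hrank
      exact hrank.trans (finrank_adjoin_singleton_le_natDegree_minpoly hint)
    · rw [← LinearMap.charpoly_natDegree (D : Module.End F K)]
      exact Polynomial.natDegree_le_of_dvd (LinearMap.minpoly_dvd_charpoly _)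
        (LinearMap.charpoly_monic _).ne_zero
  · rw [minpoly.eq_zero hint, Polynomial.natDegree_zero]
    by_contra h
    have := Module.finite_of_finrank_pos (Nat.pos_of_ne_zero h)
    exact hint (Algebra.IsIntegral.isIntegral _)

end DerivationOfField

theorem span_singleton_ne_top_of_irreducible {R : Type*} [Ring R] {f : R} (hf : Irreducible f) :
    Ideal.span {f} ≠ ⊤ := by
  rw [Ne, Ideal.eq_top_iff_one, Ideal.mem_span_singleton']
  rintro ⟨a, ha⟩
  obtain h | h := hf.isUnit_or_isUnit (a := f * a) (b := f) (by rw [mul_assoc, ha, mul_one])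
  · have hidem : f * a * (f * a) = f * a := by rw [mul_assoc, ← mul_assoc a, ha, one_mul]
    exact hf.not_isUnit (isUnit_iff_exists.mpr ⟨a, h.mul_eq_right.mp hidem, ha⟩)
  · exact hf.not_isUnit h

theorem isMaximal_span_singleton_of_irreducible {R : Type*} [Ring R] [IsPrincipalIdealRing R]
    {f : R} (hf : Irreducible f) : (Ideal.span {f}).IsMaximal := by
  refine ⟨span_singleton_ne_top_of_irreducible hf, fun J hJ ↦ ?_⟩
  obtain ⟨g, rfl⟩ := IsPrincipalIdealRing.principal J
  obtain ⟨a, rfl⟩ := Ideal.mem_span_singleton'.mp (hJ.le (Ideal.mem_span_singleton_self f))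
  obtain h | h := hf.isUnit_or_isUnit rfl
  · exact absurd (Ideal.span_singleton_mul_left_unit h g).ge hJ.not_ge
  · exact Ideal.eq_top_of_isUnit_mem _ (Ideal.mem_span_singleton_self g) h

theorem isNonassocDivision_iff_noZeroDivisors (F : Type*) {A : Type*} [Field F] [NonAssocRing A]
    [Module F A] [IsScalarTower F A A] [SMulCommClass F A A] [FiniteDimensional F A] :
    IsNonassocDivision A ↔ Nontrivial A ∧ NoZeroDivisors A := by
  refine and_congr_right fun _ ↦ ⟨fun h ↦ ⟨fun {a b} hab ↦ ?_⟩, fun _ a ha ↦ ⟨?_, ?_⟩⟩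
  · by_contra! hne
    exact hne.2 ((h a hne.1).1.injective (hab.trans (mul_zero a).symm))
  · have hinj : Function.Injective (LinearMap.mulLeft F a) := mul_right_injective₀ ha
    exact ⟨hinj, LinearMap.injective_iff_surjective.mp hinj⟩
  · have hinj : Function.Injective (LinearMap.mulRight F a) := mul_left_injective₀ ha
    exact ⟨hinj, LinearMap.injective_iff_surjective.mp hinj⟩

namespace DiffPoly

section Ring

variable {D : Type*} [Ring D] {δ : RingDerivation D}

variable (δ) in
/-- The inclusion `D → D[t;δ]` of the constants, as a ring homomorphism. -/
noncomputable def constHom : D →+* DiffPoly δ where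
  toFun := const δ
  map_one' := rfl
  map_mul' a b := (const_mul_const δ a b).symm
  map_zero' := toPoly.injective Polynomial.C_0
  map_add' := const_add δ

theorem const_zero : const δ 0 = 0 := map_zero (constHom δ)

theorem const_one : const δ 1 = 1 := map_one (constHom δ)

theorem const_injective : Function.Injective (const δ) :=
  toPoly.symm.injective.comp Polynomial.C_injective

instance instNontrivial [Nontrivial D] : Nontrivial (DiffPoly δ) := const_injective.nontrivial

theorem toPoly_const_mul_t_pow (a : D) (k : ℕ) :
    toPoly (const δ a * t δ ^ k) = Polynomial.monomial k a := by
  rw [toPoly_const_mul, toPoly_t_pow, Polynomial.C_mul_X_pow_eq_monomial]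

@[elab_as_elim]
theorem induction_on {motive : DiffPoly δ → Prop} (p : DiffPoly δ)
    (const : ∀ a, motive (const δ a)) (t : motive (t δ))
    (add : ∀ p q, motive p → motive q → motive (p + q))
    (mul : ∀ p q, motive p → motive q → motive (p * q)) : motive p := by
  obtain ⟨p, rfl⟩ := toPoly.symm.surjective p
  induction p using Polynomial.induction_on' with
  | add p q hp hq => rw [map_add]; exact add _ _ hp hq
  | monomial k a =>
    have pow_t (k : ℕ) : motive (DiffPoly.t δ ^ k) := by
      induction k with
      | zero => exact const 1
      | succ k ih => rw [pow_succ]; exact mul _ _ ih t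
    rw [← toPoly_const_mul_t_pow, AddEquiv.symm_apply_apply]
    exact mul _ _ (const a) (pow_t k)

theorem isTwoSided_span_singleton_iff {f : DiffPoly δ} : (Ideal.span {f}).IsTwoSided ↔
    (∀ a, f * const δ a ∈ Ideal.span {f}) ∧ f * t δ ∈ Ideal.span {f} := by
  have hf : f ∈ Ideal.span {f} := Ideal.mem_span_singleton_self f
  have mul_mem_of_mem {p : DiffPoly δ} (hp : f * p ∈ Ideal.span {f}) {g : DiffPoly δ}
      (hg : g ∈ Ideal.span {f}) : g * p ∈ Ideal.span {f} := by
    obtain ⟨a, rfl⟩ := Ideal.mem_span_singleton'.mp hg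
    rw [mul_assoc]
    exact Ideal.mul_mem_left _ a hp
  refine ⟨fun h ↦ ⟨fun a ↦ h.mul_mem_of_left _ hf, h.mul_mem_of_left _ hf⟩, fun ⟨hC, ht⟩ ↦
    ⟨fun p hg ↦ mul_mem_of_mem ?_ hg⟩⟩
  induction p using induction_on with
  | const a => exact hC a
  | t => exact ht
  | add p q hp hq => rw [mul_add]; exact add_mem hp hq
  | mul p q hp hq => rw [← mul_assoc]; exact mul_mem_of_mem hq hp

theorem t_pow_char_mul_const (p : ℕ) [Fact p.Prime] [CharP D p] (a : D) :
    t δ ^ p * const δ a = const δ a * t δ ^ p + const δ (δ^[p] a) := by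
  have : CharP (DiffPoly δ) p := charP_of_injective_ringHom (f := constHom δ) const_injective p
  have : CharP (Module.End ℤ (DiffPoly δ)) p :=
    charP_of_injective_ringHom (f := (Algebra.lmul ℤ (DiffPoly δ)).toRingHom)
      Algebra.lmul_injective p
  set L := LinearMap.mulLeft ℤ (t δ)
  set R := LinearMap.mulRight ℤ (t δ)
  have ad_semiconj : Function.Semiconj (const δ) δ ⇑(L - R) := fun b ↦ by
    simp [L, R, t_mul_const]
  calc t δ ^ p * const δ a = const δ a * t δ ^ p + (L ^ p - R ^ p) (const δ a) := by
        simp [L, R, LinearMap.pow_mulLeft, LinearMap.pow_mulRight]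
    _ = const δ a * t δ ^ p + (L - R)^[p] (const δ a) := by
        rw [← sub_pow_char_of_commute p (LinearMap.commute_mulLeft_right (t δ) (t δ)),
          Module.End.pow_apply]
    _ = const δ a * t δ ^ p + const δ (δ^[p] a) := by
        rw [← ad_semiconj.iterate_right p a]

end Ring

section DivisionRing

variable {D : Type*} [DivisionRing D] {δ : RingDerivation D}

theorem natDegree_tMul_pow_le (q : Polynomial D) (i : ℕ) :
    ((tMul δ ^ i) q).natDegree ≤ q.natDegree + i := by
  induction i with
  | zero => rfl
  | succ i ih =>
    rw [pow_succ', ← add_assoc]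
    exact (natDegree_tMul_le _).trans (Nat.add_le_add_right ih 1)

theorem coeff_tMul_pow_natDegree_add (q : Polynomial D) (i : ℕ) :
    ((tMul δ ^ i) q).coeff (q.natDegree + i) = q.leadingCoeff := by
  induction i with
  | zero => rfl
  | succ i ih =>
    have hlt : ((tMul δ ^ i) q).natDegree < q.natDegree + i + 1 :=
      Nat.lt_succ_of_le (natDegree_tMul_pow_le q i)
    rw [pow_succ', AddMonoid.End.coe_mul, Function.comp_apply, ← add_assoc, coeff_tMul_succ, ih,
      Polynomial.coeff_eq_zero_of_natDegree_lt hlt, map_zero, add_zero]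

theorem toPoly_mul_eq_sum (p q : DiffPoly δ) : toPoly (p * q) =
    ∑ i ∈ Finset.range (p.natDegree + 1),
      Polynomial.C ((toPoly p).coeff i) * (tMul δ ^ i) (toPoly q) := by
  conv_lhs => rw [toPoly_mul, (toPoly p).as_sum_range, map_sum]
  exact (AddMonoidHom.finsetSum_apply _ _ _).trans
    (Finset.sum_congr rfl fun i _ ↦ leftMul_monomial δ i _ _)

theorem natDegree_mul_le (p q : DiffPoly δ) : (p * q).natDegree ≤ p.natDegree + q.natDegree := by
  rw [natDegree, toPoly_mul_eq_sum]
  refine Polynomial.natDegree_sum_le_of_forall_le _ _ fun i hi ↦ ?_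
  have hi : i ≤ p.natDegree := Finset.mem_range_succ_iff.mp hi
  calc _ ≤ ((tMul δ ^ i) (toPoly q)).natDegree := Polynomial.natDegree_C_mul_le _ _
    _ ≤ q.natDegree + i := natDegree_tMul_pow_le _ i
    _ ≤ p.natDegree + q.natDegree := by lia

theorem coeff_mul_natDegree_add (p q : DiffPoly δ) :
    (toPoly (p * q)).coeff (p.natDegree + q.natDegree) =
      (toPoly p).leadingCoeff * (toPoly q).leadingCoeff := by
  rw [toPoly_mul_eq_sum, Polynomial.finsetSum_coeff, Finset.sum_range_succ, Finset.sum_eq_zero,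
    zero_add, Polynomial.coeff_C_mul, add_comm p.natDegree]
  · exact congrArg _ (coeff_tMul_pow_natDegree_add _ _)
  · intro i hi
    have hlt : ((tMul δ ^ i) (toPoly q)).natDegree < p.natDegree + q.natDegree := by
      rw [add_comm p.natDegree]
      exact (natDegree_tMul_pow_le _ i).trans_lt (Nat.add_lt_add_left (Finset.mem_range.mp hi) _)
    rw [Polynomial.coeff_C_mul, Polynomial.coeff_eq_zero_of_natDegree_lt hlt, mul_zero]

theorem toPoly_ne_zero {p : DiffPoly δ} (hp : p ≠ 0) : toPoly p ≠ 0 :=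
  (map_ne_zero_iff toPoly toPoly.injective).mpr hp

theorem coeff_mul_natDegree_add_ne_zero {p q : DiffPoly δ} (hp : p ≠ 0) (hq : q ≠ 0) :
    (toPoly (p * q)).coeff (p.natDegree + q.natDegree) ≠ 0 := by
  rw [coeff_mul_natDegree_add]
  exact mul_ne_zero (Polynomial.leadingCoeff_ne_zero.mpr (toPoly_ne_zero hp))
    (Polynomial.leadingCoeff_ne_zero.mpr (toPoly_ne_zero hq))

instance instNoZeroDivisors : NoZeroDivisors (DiffPoly δ) where
  eq_zero_or_eq_zero_of_mul_eq_zero {p q} hpq := by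
    by_contra! hne
    refine coeff_mul_natDegree_add_ne_zero hne.1 hne.2 ?_
    rw [hpq, map_zero, Polynomial.coeff_zero]

theorem natDegree_mul {p q : DiffPoly δ} (hp : p ≠ 0) (hq : q ≠ 0) :
    (p * q).natDegree = p.natDegree + q.natDegree :=
  (natDegree_mul_le p q).antisymm
    (Polynomial.le_natDegree_of_ne_zero (coeff_mul_natDegree_add_ne_zero hp hq))

theorem natDegree_zero : (0 : DiffPoly δ).natDegree = 0 := Polynomial.natDegree_zero

theorem ne_zero_of_natDegree_pos {f : DiffPoly δ} (hf : 0 < f.natDegree) : f ≠ 0 := by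
  rintro rfl
  exact hf.ne' natDegree_zero

theorem natDegree_const (a : D) : (const δ a).natDegree = 0 := Polynomial.natDegree_C a

theorem natDegree_t_sub_const (z : D) : (t δ - const δ z).natDegree = 1 :=
  Polynomial.natDegree_X_sub_C z

theorem natDegree_eq_zero {p : DiffPoly δ} : p.natDegree = 0 ↔ ∃ a, const δ a = p :=
  Polynomial.natDegree_eq_zero

theorem isUnit_const {a : D} (ha : a ≠ 0) : IsUnit (const δ a) := ha.isUnit.map (constHom δ)

theorem isUnit_iff_natDegree_eq_zero {p : DiffPoly δ} (hp : p ≠ 0) :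
    IsUnit p ↔ p.natDegree = 0 := by
  constructor
  · rintro ⟨u, rfl⟩
    have h := natDegree_mul u.ne_zero u⁻¹.ne_zero
    rw [u.mul_inv, ← const_one, natDegree_const] at h
    lia
  · intro h
    obtain ⟨a, rfl⟩ := natDegree_eq_zero.mp h
    exact isUnit_const fun ha ↦ hp (ha ▸ const_zero)

theorem const_mem_span_singleton_iff {f : DiffPoly δ} (hf : 0 < f.natDegree) {a : D} :
    const δ a ∈ Ideal.span {f} ↔ a = 0 := by
  refine ⟨fun h ↦ ?_, fun h ↦ by rw [h, const_zero]; exact zero_mem _⟩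
  obtain ⟨q, hq⟩ := Ideal.mem_span_singleton'.mp h
  have hf0 := ne_zero_of_natDegree_pos hf
  obtain rfl | hq0 := eq_or_ne q 0
  · exact const_injective (hq.symm.trans (by rw [zero_mul, const_zero]))
  · have := natDegree_mul hq0 hf0
    rw [hq, natDegree_const] at this
    lia

theorem dvd_const_iff {f : DiffPoly δ} (hf : 0 < f.natDegree) {a : D} :
    f ∣ const δ a ↔ a = 0 := by
  refine ⟨fun ⟨q, hq⟩ ↦ ?_, fun h ↦ by rw [h, const_zero]; exact dvd_zero f⟩
  have hf0 := ne_zero_of_natDegree_pos hf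
  obtain rfl | hq0 := eq_or_ne q 0
  · exact const_injective (hq.trans (by rw [mul_zero, const_zero]))
  · have := natDegree_mul hf0 hq0
    rw [← hq, natDegree_const] at this
    lia

theorem natDegree_const_mul {a : D} (ha : a ≠ 0) (p : DiffPoly δ) :
    (const δ a * p).natDegree = p.natDegree := by
  rw [natDegree, toPoly_const_mul, Polynomial.natDegree_C_mul ha, natDegree]

theorem monic_const_inv_mul {p : DiffPoly δ} (hp : p ≠ 0) :
    (const δ (toPoly p).leadingCoeff⁻¹ * p).Monic := by
  rw [Monic, toPoly_const_mul, Polynomial.Monic, Polynomial.leadingCoeff_mul,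
    Polynomial.leadingCoeff_C,
    inv_mul_cancel₀ (Polynomial.leadingCoeff_ne_zero.mpr (toPoly_ne_zero hp))]

theorem Monic.exists_eq_mul_add {f : DiffPoly δ} (hf : f.Monic) (g : DiffPoly δ) :
    ∃ q r, g = q * f + r ∧ (r ≠ 0 → r.natDegree < f.natDegree) := by
  obtain ⟨q, hq⟩ := modR_spec hf g
  refine ⟨q, _, hq, fun hr ↦ Polynomial.natDegree_lt_iff_degree_lt (toPoly_ne_zero hr) |>.mpr ?_⟩
  exact Polynomial.mem_degreeLT.mp (modR hf g).2

instance instIsPrincipalIdealRing : IsPrincipalIdealRing (DiffPoly δ) where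
  principal I := by
    obtain rfl | hI := eq_or_ne I ⊥
    · exact bot_isPrincipal
    have monic_mem {g : DiffPoly δ} (hgI : g ∈ I) (hg : g ≠ 0) :
        ∃ f ∈ I, f.Monic ∧ f.natDegree = g.natDegree :=
      ⟨_, I.mul_mem_left _ hgI, monic_const_inv_mul hg, natDegree_const_mul
        (inv_ne_zero (Polynomial.leadingCoeff_ne_zero.mpr (toPoly_ne_zero hg))) g⟩
    obtain ⟨g, hgI, hg⟩ := Submodule.exists_mem_ne_zero_of_ne_bot hI
    obtain ⟨f₀, hf₀I, hf₀, -⟩ := monic_mem hgI hg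
    obtain ⟨f, ⟨hfI, hf⟩, hmin⟩ := exists_minimalFor_of_wellFoundedLT
      (fun f : DiffPoly δ ↦ f ∈ I ∧ f.Monic) natDegree ⟨f₀, hf₀I, hf₀⟩
    refine ⟨f, le_antisymm (fun g hg ↦ ?_) ((Ideal.span_singleton_le_iff_mem I).mpr hfI)⟩
    obtain ⟨q, r, rfl, hr⟩ := hf.exists_eq_mul_add g
    have hrI : r ∈ I := (I.add_mem_iff_right (I.mul_mem_left q hfI)).mp hg
    suffices r = 0 from Ideal.mem_span_singleton'.mpr ⟨q, by rw [this, add_zero]⟩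
    by_contra hr0
    obtain ⟨s, hsI, hs, hsr⟩ := monic_mem hrI hr0
    have : f.natDegree ≤ s.natDegree := hmin ⟨hsI, hs⟩ (hsr ▸ (hr hr0).le)
    exact absurd (hr hr0) (hsr ▸ this).not_gt

theorem irreducible_iff_natDegree {f : DiffPoly δ} (hf : 0 < f.natDegree) : Irreducible f ↔
    ∀ p q, f = p * q → p.natDegree = 0 ∨ q.natDegree = 0 := by
  have hf0 := ne_zero_of_natDegree_pos hf
  rw [irreducible_iff, isUnit_iff_natDegree_eq_zero hf0, and_iff_right hf.ne']
  refine forall₂_congr fun p q ↦ imp_congr_right ?_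
  rintro rfl
  rw [isUnit_iff_natDegree_eq_zero (left_ne_zero_of_mul hf0),
    isUnit_iff_natDegree_eq_zero (right_ne_zero_of_mul hf0)]

theorem exists_eq_const_mul_t_sub_const {p : DiffPoly δ} (hp : p.natDegree = 1) :
    ∃ a ≠ 0, ∃ z, p = const δ a * (t δ - const δ z) := by
  obtain ⟨a, ha, b, hab⟩ := Polynomial.natDegree_eq_one.mp hp
  refine ⟨a, ha, -(a⁻¹ * b), toPoly.injective ?_⟩
  rw [toPoly_const_mul, sub_eq, ← hab]
  change _ = Polynomial.C a * (Polynomial.X - Polynomial.C (-(a⁻¹ * b)))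
  rw [map_neg, sub_neg_eq_add, mul_add, ← map_mul, mul_inv_cancel_left₀ ha]

theorem exists_eq_t_sub_const_mul_const {p : DiffPoly δ} (hp : p.natDegree = 1) :
    ∃ a z, p = (t δ - const δ z) * const δ a := by
  obtain ⟨a, ha, z, rfl⟩ := exists_eq_const_mul_t_sub_const hp
  refine ⟨a, (a * z + δ a) * a⁻¹, ?_⟩
  rw [mul_sub, sub_mul, t_mul_const, const_mul_const, const_mul_const, inv_mul_cancel_right₀ ha,
    const_add, add_sub_add_right_eq_sub]

theorem irreducible_iff_of_natDegree_le_three {f : DiffPoly δ} (h2 : 2 ≤ f.natDegree)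
    (h3 : f.natDegree ≤ 3) :
    Irreducible f ↔ ∀ z, f ∉ Ideal.span {t δ - const δ z} ∧ ¬ t δ - const δ z ∣ f := by
  have hf0 := ne_zero_of_natDegree_pos (two_pos.trans_le h2)
  rw [irreducible_iff_natDegree (two_pos.trans_le h2)]
  constructor
  · refine fun h z ↦ ⟨fun hmem ↦ ?_, fun ⟨q, hq⟩ ↦ ?_⟩
    · obtain ⟨q, rfl⟩ := Ideal.mem_span_singleton'.mp hmem
      have := natDegree_mul (left_ne_zero_of_mul hf0) (right_ne_zero_of_mul hf0)
      have := h _ _ rfl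
      rw [natDegree_t_sub_const] at *
      lia
    · subst hq
      have := natDegree_mul (left_ne_zero_of_mul hf0) (right_ne_zero_of_mul hf0)
      have := h _ _ rfl
      rw [natDegree_t_sub_const] at *
      lia
  · rintro h p q rfl
    by_contra! hpq
    have hdeg := natDegree_mul (left_ne_zero_of_mul hf0) (right_ne_zero_of_mul hf0)
    obtain hp | hq : p.natDegree = 1 ∨ q.natDegree = 1 := by lia
    · obtain ⟨a, z, rfl⟩ := exists_eq_t_sub_const_mul_const hp
      exact (h z).2 ⟨const δ a * q, mul_assoc _ _ _⟩
    · obtain ⟨a, -, z, rfl⟩ := exists_eq_const_mul_t_sub_const hq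
      exact (h z).1 (Ideal.mem_span_singleton'.mpr ⟨p * const δ a, mul_assoc _ _ _⟩)

end DivisionRing

end DiffPoly

namespace DiffPoly

variable {D : Type*} [DivisionRing D] {δ : RingDerivation D}

/-- Conjugation `p ↦ u p u⁻¹` of `D[t;δ]` by a unit `u` of `D`. -/
noncomputable def conj : Dˣ →* RingAut (DiffPoly δ) :=
  (MulSemiringAction.toRingAut (ConjAct (DiffPoly δ)ˣ) (DiffPoly δ)).comp
    (ConjAct.toConjAct.toMonoidHom.comp (Units.map (constHom δ).toMonoidHom))

theorem conj_apply (u : Dˣ) (p : DiffPoly δ) :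
    conj u p = const δ u * p * const δ (u⁻¹ : Dˣ) := rfl

theorem conj_apply_eq_iff {u : Dˣ} {p q : DiffPoly δ} :
    conj u p = q ↔ const δ u * p = q * const δ u :=
  (Units.map (constHom δ).toMonoidHom u).mul_inv_eq_iff_eq_mul

theorem natDegree_conj (u : Dˣ) (p : DiffPoly δ) : (conj u p).natDegree = p.natDegree := by
  obtain rfl | hp := eq_or_ne p 0
  · rw [map_zero]
  have hconst (v : Dˣ) : const δ v ≠ 0 := (isUnit_const v.ne_zero).ne_zero
  rw [conj_apply, natDegree_mul (mul_ne_zero (hconst u) hp) (hconst u⁻¹), natDegree_const,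
    natDegree_const_mul u.ne_zero, add_zero]

theorem conj_const (u : Dˣ) (a : δ.constField) :
    conj u (const δ (a : Subring.center D)) = const δ (a : Subring.center D) :=
  conj_apply_eq_iff.mpr (const_comm a _)

theorem conj_eq_one_iff {u : Dˣ} :
    (conj u : RingAut (DiffPoly δ)) = 1 ↔ (u : D) ∈ Subring.center D ∧ δ u = 0 := by
  simp only [RingEquiv.ext_iff, RingAut.one_apply, conj_apply_eq_iff]
  refine ⟨fun h ↦ ⟨?_, ?_⟩, fun ⟨hu, hδu⟩ p ↦ (const_comm ⟨⟨(u : D), hu⟩, hδu⟩ p).symm⟩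
  · refine Subring.mem_center_iff.mpr fun a ↦ const_injective (δ := δ) ?_
    rw [← const_mul_const, ← const_mul_const, h]
  · have := h (t δ)
    rw [t_mul_const, left_eq_add] at this
    exact const_injective (this.trans const_zero.symm)

/-- The automorphisms of `D[t;δ]` over `F` that preserve the degree and fix `f`; these induce
automorphisms of `S_f`. -/
def fixingAut (f : DiffPoly δ) : Subgroup (RingAut (DiffPoly δ)) where
  carrier := {σ | (∀ p, (σ p).natDegree = p.natDegree) ∧ σ f = f ∧
    ∀ a : δ.constField, σ (const δ (a : Subring.center D)) = const δ (a : Subring.center D)}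
  mul_mem' {σ _} hσ hτ := ⟨fun p ↦ (hσ.1 _).trans (hτ.1 p),
    (congrArg σ hτ.2.1).trans hσ.2.1, fun a ↦ (congrArg σ (hτ.2.2 a)).trans (hσ.2.2 a)⟩
  one_mem' := ⟨fun _ ↦ rfl, rfl, fun _ ↦ rfl⟩
  inv_mem' {σ} hσ :=
    ⟨fun p ↦ (hσ.1 _).symm.trans (congrArg natDegree (σ.apply_symm_apply p)),
      σ.symm_apply_eq.mpr hσ.2.1.symm, fun a ↦ σ.symm_apply_eq.mpr (hσ.2.2 a).symm⟩

theorem conj_mem_fixingAut_iff {f : DiffPoly δ} {u : Dˣ} :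
    conj u ∈ fixingAut f ↔ f * const δ u = const δ u * f :=
  ⟨fun h ↦ (conj_apply_eq_iff.mp h.2.1).symm,
    fun h ↦ ⟨natDegree_conj u, conj_apply_eq_iff.mpr h.symm, conj_const u⟩⟩

section Cubic

theorem natDegree_cubicPoly (c d : D) : (cubicPoly δ c d).natDegree = 3 := by
  have h : toPoly (cubicPoly δ c d)
      = Polynomial.X ^ 3 - Polynomial.C c * Polynomial.X - Polynomial.C d := by
    rw [cubicPoly, sub_eq, sub_eq, toPoly_t_pow, toPoly_const_mul]
    rfl
  rw [natDegree, h]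
  compute_degree!

theorem t_sub_const_pow_three_eq_sub_V [CharP D 3] (z : D) :
    (t δ - const δ z) ^ 3 = t δ ^ 3 - const δ (V δ 3 z) := by
  rw [t_sub_const_pow_three, V_three]

theorem cubicPoly_eq_mul_t_sub_const_add [CharP D 3] (c d z : D) :
    cubicPoly δ c d = ((t δ - const δ z) ^ 2 - const δ c) * (t δ - const δ z) +
      const δ (V δ 3 z - c * z - d) := by
  rw [sub_mul, ← pow_succ, t_sub_const_pow_three_eq_sub_V, cubicPoly, const_sub, const_sub,
    ← const_mul_const, mul_sub]
  abel

theorem cubicPoly_eq_t_sub_const_mul_add [CharP D 3] (c d z : D) :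
    cubicPoly δ c d = (t δ - const δ z) * ((t δ - const δ z) ^ 2 - const δ c) +
      const δ (V δ 3 z - z * c - d + δ c) := by
  rw [mul_sub, ← pow_succ', t_sub_const_pow_three_eq_sub_V, cubicPoly, const_add, const_sub,
    const_sub, ← const_mul_const, sub_mul, t_mul_const]
  abel

theorem cubicPoly_mem_span_t_sub_const_iff [CharP D 3] {c d z : D} :
    cubicPoly δ c d ∈ Ideal.span {t δ - const δ z} ↔ V δ 3 z - c * z = d := by
  rw [cubicPoly_eq_mul_t_sub_const_add c d z, Ideal.add_mem_iff_right _
    (Ideal.mul_mem_left _ _ (Ideal.mem_span_singleton_self _)),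
    const_mem_span_singleton_iff (by rw [natDegree_t_sub_const]; exact one_pos), sub_eq_zero]

theorem t_sub_const_dvd_cubicPoly_iff [CharP D 3] {c d z : D} :
    t δ - const δ z ∣ cubicPoly δ c d ↔ V δ 3 z - z * c - d + δ c = 0 := by
  rw [cubicPoly_eq_t_sub_const_mul_add c d z, dvd_add_right (dvd_mul_right _ _),
    dvd_const_iff (by rw [natDegree_t_sub_const]; exact one_pos)]

theorem irreducible_cubicPoly_iff [CharP D 3] (c d : D) : Irreducible (cubicPoly δ c d) ↔
    ∀ z, V δ 3 z - c * z ≠ d ∧ V δ 3 z - z * c - d + δ c ≠ 0 := by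
  have h3 := natDegree_cubicPoly (δ := δ) c d
  simp only [irreducible_iff_of_natDegree_le_three (h3.symm ▸ Nat.le_succ 2) h3.le,
    cubicPoly_mem_span_t_sub_const_iff, t_sub_const_dvd_cubicPoly_iff, ne_eq]

theorem cubicPoly_mul_const [CharP D 3] {c : D} (hc : c ∈ Subring.center D) (d a : D) :
    cubicPoly δ c d * const δ a = const δ a * cubicPoly δ c d +
      const δ (δ (δ (δ a)) - c * δ a + (a * d - d * a)) := by
  have : Fact (Nat.Prime 3) := ⟨Nat.prime_three⟩
  have ht3 : t δ ^ 3 * const δ a = const δ a * t δ ^ 3 + const δ (δ (δ (δ a))) :=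
    t_pow_char_mul_const 3 a
  have hct : const δ c * t δ * const δ a = const δ a * (const δ c * t δ) + const δ (c * δ a) := by
    rw [mul_assoc, t_mul_const, mul_add, const_mul_const, ← mul_assoc, ← mul_assoc,
      const_mul_const, const_mul_const, Subring.mem_center_iff.mp hc]
  rw [cubicPoly, sub_mul, sub_mul, ht3, hct, mul_sub, mul_sub, const_mul_const, const_mul_const,
    const_add, const_sub, const_sub]
  abel

theorem cubicPoly_mul_t {c : D} (hc : δ c = 0) (d : D) :
    cubicPoly δ c d * t δ = t δ * cubicPoly δ c d + const δ (δ d) := by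
  rw [cubicPoly, sub_mul, sub_mul, mul_sub, mul_sub, ← mul_assoc (t δ), t_mul_const, t_mul_const,
    hc, const_zero, add_zero, mul_assoc, ← pow_succ, ← pow_succ']
  abel

theorem isTwoSided_span_cubicPoly_iff [CharP D 3] (c : δ.constField) (d : D) :
    (Ideal.span {cubicPoly δ c d}).IsTwoSided ↔
      (∀ a, δ (δ (δ a)) - c * δ a + (a * d - d * a) = 0) ∧ δ d = 0 := by
  have h3 : 0 < (cubicPoly δ (c : Subring.center D) d).natDegree :=
    natDegree_cubicPoly (δ := δ) (c : Subring.center D) d ▸ three_pos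
  have hc : δ (c : Subring.center D) = 0 := c.2
  have hmem (p : DiffPoly δ) : p * cubicPoly δ c d ∈ Ideal.span {cubicPoly δ c d} :=
    Ideal.mul_mem_left _ p (Ideal.mem_span_singleton_self _)
  simp only [isTwoSided_span_singleton_iff, cubicPoly_mul_const (c : Subring.center D).2,
    cubicPoly_mul_t hc, Ideal.add_mem_iff_right _ (hmem _), const_mem_span_singleton_iff h3]

theorem isTwoSided_span_cubicPoly_iff_of_forall [CharP D 3] (c : δ.constField) (d : D)
    (hδ : ∀ a, δ (δ (δ a)) = c * δ a) : (Ideal.span {cubicPoly δ c d}).IsTwoSided ↔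
      ∃ a : δ.constField, ((a : Subring.center D) : D) = d := by
  simp only [isTwoSided_span_cubicPoly_iff, hδ, sub_self, zero_add, sub_eq_zero]
  exact ⟨fun ⟨hd, hδd⟩ ↦ ⟨⟨⟨d, Subring.mem_center_iff.mpr hd⟩, hδd⟩, rfl⟩, by
    rintro ⟨a, rfl⟩; exact ⟨Subring.mem_center_iff.mp (a : Subring.center D).2, a.2⟩⟩

theorem conj_mem_fixingAut_cubicPoly [CharP D 3] (c : δ.constField) (d : D)
    {u : Dˣ} (hu : (u : D) ∈ Subring.center D) (hδu : δ (δ (δ u)) = c * δ u) :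
    conj u ∈ fixingAut (cubicPoly δ c d) := by
  rw [conj_mem_fixingAut_iff, cubicPoly_mul_const (c : Subring.center D).2, hδu, sub_self,
    zero_add, Subring.mem_center_iff.mp hu d, sub_self, const_zero, add_zero]

end Cubic

end DiffPoly

namespace PetitAlgebra

open DiffPoly

variable {D : Type*} [DivisionRing D] {δ : RingDerivation D} {f : DiffPoly δ} {hf : f.Monic}

section Remainder

theorem proj_eq_zero_iff {p : DiffPoly δ} : proj hf p = 0 ↔ p ∈ Ideal.span {f} := by
  rw [Ideal.mem_span_singleton']
  refine ⟨fun h ↦ ?_, ?_⟩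
  · obtain ⟨q, hq⟩ := modR_spec hf p
    have hr : modR hf p = 0 := h
    rw [hr, ZeroMemClass.coe_zero, map_zero, add_zero] at hq
    exact ⟨q, hq.symm⟩
  · rintro ⟨q, rfl⟩
    exact modR_eq hf (q := q) (add_zero _).symm

theorem proj_eq_proj_iff {p q : DiffPoly δ} : proj hf p = proj hf q ↔ p - q ∈ Ideal.span {f} := by
  rw [← sub_eq_zero, ← map_sub, proj_eq_zero_iff]

theorem lift_proj_sub_mem (p : DiffPoly δ) : lift (proj hf p) - p ∈ Ideal.span {f} :=
  proj_eq_proj_iff.mp (proj_lift (proj hf p))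

theorem lift_eq_zero_iff {x : PetitAlgebra f hf} : lift x = 0 ↔ x = 0 :=
  map_eq_zero_iff lift (Function.LeftInverse.injective proj_lift)

theorem natDegree_lift_lt {x : PetitAlgebra f hf} (hx : x ≠ 0) :
    (lift x).natDegree < f.natDegree :=
  (Polynomial.natDegree_lt_iff_degree_lt (toPoly_ne_zero (lift_eq_zero_iff.not.mpr hx))).mpr
    (Polynomial.mem_degreeLT.mp (show Polynomial.degreeLT D f.natDegree from x).2)

theorem lift_proj {p : DiffPoly δ} (hp : p.natDegree < f.natDegree) : lift (proj hf p) = p := by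
  have hmem : toPoly p ∈ Polynomial.degreeLT D f.natDegree :=
    Polynomial.mem_degreeLT.mpr (Polynomial.degree_le_natDegree.trans_lt (by exact_mod_cast hp))
  exact congrArg (fun x : Polynomial.degreeLT D f.natDegree ↦ toPoly.symm x.1)
    (modR_self hf ⟨_, hmem⟩)

theorem lift_proj_t_pow_natDegree (hf0 : f.natDegree ≠ 0) :
    lift (proj hf (t δ ^ f.natDegree)) = t δ ^ f.natDegree - f := by
  have hf' : Polynomial.IsMonicOfDegree (toPoly f) f.natDegree := ⟨rfl, hf⟩
  have hlt : (t δ ^ f.natDegree - f).natDegree < f.natDegree := by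
    rw [DiffPoly.natDegree, sub_eq, toPoly_t_pow]
    exact (Polynomial.isMonicOfDegree_X_pow D _).natDegree_sub_lt hf0 hf'
  rw [← lift_proj (hf := hf) hlt, proj_eq_proj_iff.mpr]
  rw [sub_sub_cancel]
  exact Ideal.mem_span_singleton_self f

end Remainder

section Dimension

/-- The `D`-linear identification of `S_f` with its coefficient vectors. -/
noncomputable def coeffEquiv (hf : f.Monic) : PetitAlgebra f hf ≃ₗ[D] (Fin f.natDegree → D) :=
  Polynomial.degreeLTEquiv D f.natDegree

instance : Module.Finite D (PetitAlgebra f hf) := Module.Finite.equiv (coeffEquiv hf).symm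

theorem finrank_eq_natDegree : Module.finrank D (PetitAlgebra f hf) = f.natDegree := by
  rw [(coeffEquiv hf).finrank_eq, Module.finrank_fin_fun]

theorem nontrivial_iff : Nontrivial (PetitAlgebra f hf) ↔ 0 < f.natDegree := by
  rw [← finrank_eq_natDegree (hf := hf), Module.finrank_pos_iff]

/-- The map `coeffEquiv`, regarded as linear over the field of central constants only. -/
noncomputable def coeffEquivConst (hf : f.Monic) :
    PetitAlgebra f hf ≃ₗ[δ.constField] (Fin f.natDegree → D) :=
  { coeffEquiv hf with
    map_smul' a x := (coeffEquiv hf).map_smul ((a : Subring.center D) : D) x }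

instance [FiniteDimensional δ.constField D] : FiniteDimensional δ.constField (PetitAlgebra f hf) :=
  Module.Finite.equiv (coeffEquivConst hf).symm

theorem finrank_eq_natDegree_mul [FiniteDimensional δ.constField D] :
    Module.finrank δ.constField (PetitAlgebra f hf) =
      f.natDegree * Module.finrank δ.constField D := by
  rw [(coeffEquivConst hf).finrank_eq, Module.finrank_pi_fintype, Finset.sum_const,
    Finset.card_univ, Fintype.card_fin, smul_eq_mul]

end Dimension

section Division

variable {g : DiffPoly δ} {hg : g.Monic}

variable (hf hg) in
/-- Right multiplication by `h`, as a `D`-linear map from the polynomials of degree less than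
`deg g` to the residues modulo `f`. When it is onto, comparing dimensions gives `deg f ≤ deg g`. -/
noncomputable def mulRightMod (h : DiffPoly δ) : PetitAlgebra g hg →ₗ[D] PetitAlgebra f hf where
  toFun x := proj hf (lift x * h)
  map_add' x y := by rw [map_add, add_mul, map_add]
  map_smul' a x := by
    have hlift : lift (a • x) = const δ a * lift x := by
      apply toPoly.injective
      rw [toPoly_const_mul, ← Polynomial.smul_eq_C_mul]
      rfl
    rw [hlift, mul_assoc]
    exact modR_const_mul hf a (lift x * h)

theorem mulRightMod_surjective (hmax : (Ideal.span {f}).IsMaximal) {h : DiffPoly δ}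
    (hh : h ∉ Ideal.span {f}) (hgh : g * h ∈ Ideal.span {f}) :
    Function.Surjective (mulRightMod hf hg h) := by
  intro y
  obtain ⟨a, b, hb, hab⟩ := hmax.exists_inv hh
  obtain ⟨q, hq⟩ := Ideal.mem_span_singleton'.mp (lift_proj_sub_mem (hf := hg) (lift y * a))
  refine ⟨proj hg (lift y * a), ?_⟩
  nth_rewrite 2 [← proj_lift y]
  have hsplit : lift (proj hg (lift y * a)) * h - lift y = q * (g * h) - lift y * b := by
    rw [← mul_assoc, hq, sub_mul, mul_assoc (lift y), eq_sub_of_add_eq hab, mul_sub, mul_one]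
    abel
  refine proj_eq_proj_iff.mpr (hsplit ▸ sub_mem ?_ ?_)
  exacts [Ideal.mul_mem_left _ _ hgh, Ideal.mul_mem_left _ _ hb]

theorem natDegree_le_of_mul_mem_span (hf : f.Monic) (hmax : (Ideal.span {f}).IsMaximal)
    {g h : DiffPoly δ} (hg : g ≠ 0) (hh : h ∉ Ideal.span {f}) (hgh : g * h ∈ Ideal.span {f}) :
    f.natDegree ≤ g.natDegree := by
  rw [← natDegree_const_mul (inv_ne_zero (Polynomial.leadingCoeff_ne_zero.mpr
    (toPoly_ne_zero hg))) g, ← finrank_eq_natDegree (hf := hf),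
    ← finrank_eq_natDegree (hf := monic_const_inv_mul hg)]
  refine LinearMap.finrank_le_finrank_of_surjective (mulRightMod_surjective hmax hh ?_)
  rw [mul_assoc]
  exact Ideal.mul_mem_left _ _ hgh

theorem noZeroDivisors_of_irreducible (hirr : Irreducible f) :
    NoZeroDivisors (PetitAlgebra f hf) where
  eq_zero_or_eq_zero_of_mul_eq_zero {x y} hxy := by
    by_contra! hne
    refine (natDegree_lift_lt hne.1).not_ge (natDegree_le_of_mul_mem_span hf
      (isMaximal_span_singleton_of_irreducible hirr) (lift_eq_zero_iff.not.mpr hne.1)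
      (h := lift y) ?_ (proj_eq_zero_iff.mp hxy))
    rw [← proj_eq_zero_iff (hf := hf), proj_lift]
    exact hne.2

theorem irreducible_of_noZeroDivisors (hf0 : 0 < f.natDegree) [NoZeroDivisors (PetitAlgebra f hf)] :
    Irreducible f := by
  refine (irreducible_iff_natDegree hf0).mpr fun p q hpq ↦ ?_
  have hp : p ≠ 0 := left_ne_zero_of_mul (hpq ▸ ne_zero_of_natDegree_pos hf0)
  have hq : q ≠ 0 := right_ne_zero_of_mul (hpq ▸ ne_zero_of_natDegree_pos hf0)
  have hdeg : f.natDegree = p.natDegree + q.natDegree := hpq ▸ natDegree_mul hp hq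
  by_contra! hpos
  have hp' : lift (proj hf p) = p := lift_proj (by lia)
  have hq' : lift (proj hf q) = q := lift_proj (by lia)
  have hmul : proj hf p * proj hf q = 0 := by
    rw [mul_def, hp', hq', ← hpq, proj_eq_zero_iff]
    exact Ideal.mem_span_singleton_self f
  obtain h | h := mul_eq_zero.mp hmul
  · exact hp (by rw [← hp', h, map_zero])
  · exact hq (by rw [← hq', h, map_zero])

theorem isNonassocDivision_iff_irreducible [FiniteDimensional δ.constField D] :
    IsNonassocDivision (PetitAlgebra f hf) ↔ Irreducible f := by
  -- Instance search finds an `F`-action on `S_f` other than `instModuleConst`; they agree by `rfl`.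
  have : @IsScalarTower δ.constField (PetitAlgebra f hf) (PetitAlgebra f hf)
      instModuleConst.toSMul _ instModuleConst.toSMul := instIsScalarTower
  have : @SMulCommClass δ.constField (PetitAlgebra f hf) (PetitAlgebra f hf)
      instModuleConst.toSMul _ := instSMulCommClass
  rw [isNonassocDivision_iff_noZeroDivisors δ.constField, nontrivial_iff]
  refine ⟨fun ⟨hf0, _⟩ ↦ irreducible_of_noZeroDivisors (hf := hf) hf0, fun h ↦
    ⟨Nat.pos_of_ne_zero fun hf0 ↦ ?_, noZeroDivisors_of_irreducible h⟩⟩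
  exact h.not_isUnit ((isUnit_iff_natDegree_eq_zero h.ne_zero).mpr hf0)

end Division

section Associativity

theorem mul_assoc_of_isTwoSided (h : (Ideal.span {f}).IsTwoSided) (x y z : PetitAlgebra f hf) :
    x * y * z = x * (y * z) := by
  rw [mul_def x (y * z), mul_def y z, proj_mul_right, mul_def (x * y) z, mul_def x y, ← mul_assoc,
    proj_eq_proj_iff, ← sub_mul]
  exact h.mul_mem_of_left _ (lift_proj_sub_mem _)

theorem isTwoSided_of_mul_assoc (hf2 : 2 ≤ f.natDegree)
    (h : ∀ x y z : PetitAlgebra f hf, x * y * z = x * (y * z)) :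
    (Ideal.span {f}).IsTwoSided := by
  have lift_proj_t_pow {k : ℕ} (hk : k < f.natDegree) : lift (proj hf (t δ ^ k)) = t δ ^ k :=
    lift_proj (by rwa [DiffPoly.natDegree, toPoly_t_pow, Polynomial.natDegree_X_pow])
  have mul_mem (p : DiffPoly δ) : f * p ∈ Ideal.span {f} := by
    -- Compare the two products of `t ^ (m - 1)`, `t` and `p`, where `t ^ m ≡ t ^ m - f`.
    have assoc := h (proj hf (t δ ^ (f.natDegree - 1))) (proj hf (t δ ^ 1)) (proj hf p)
    simp only [mul_def, proj_mul_right] at assoc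
    rw [lift_proj_t_pow (by lia), lift_proj_t_pow (by lia), ← mul_assoc, ← pow_add,
      Nat.sub_add_cancel (by lia), lift_proj_t_pow_natDegree (by lia), eq_comm,
      proj_eq_proj_iff, ← sub_mul, sub_sub_cancel] at assoc
    exact assoc
  exact isTwoSided_span_singleton_iff.mpr ⟨fun a ↦ mul_mem _, mul_mem _⟩

theorem mul_assoc_iff_isTwoSided (hf2 : 2 ≤ f.natDegree) :
    (∀ x y z : PetitAlgebra f hf, x * y * z = x * (y * z)) ↔ (Ideal.span {f}).IsTwoSided :=
  ⟨isTwoSided_of_mul_assoc hf2, mul_assoc_of_isTwoSided⟩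

end Associativity

section Automorphisms

variable {σ : RingAut (DiffPoly δ)}

theorem lift_proj_map_lift (hσ : σ ∈ fixingAut f) (x : PetitAlgebra f hf) :
    lift (proj hf (σ (lift x))) = σ (lift x) := by
  obtain rfl | hx := eq_or_ne x 0
  · simp only [map_zero]
  · exact lift_proj ((hσ.1 _).trans_lt (natDegree_lift_lt hx))

theorem proj_map_lift_proj (hσ : σ ∈ fixingAut f) (p : DiffPoly δ) :
    proj hf (σ (lift (proj hf p))) = proj hf (σ p) := by
  obtain ⟨q, hq⟩ := Ideal.mem_span_singleton'.mp (lift_proj_sub_mem (hf := hf) p)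
  rw [proj_eq_proj_iff, ← map_sub, ← hq, map_mul, hσ.2.1]
  exact Ideal.mul_mem_left _ _ (Ideal.mem_span_singleton_self f)

theorem proj_map_lift_smul (hσ : σ ∈ fixingAut f) (a : δ.constField) (x : PetitAlgebra f hf) :
    proj hf (σ (lift (a • x))) = a • proj hf (σ (lift x)) := by
  rw [lift_smul, map_mul, hσ.2.2, smul_def, proj_mul_right]

/-- The automorphism `x ↦ σ(x) mod_r f` of `S_f` induced by an automorphism `σ` of `D[t;δ]` that
preserves the degree and fixes `f`. -/
noncomputable def inducedAut (hf : f.Monic) :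
    fixingAut f →* nonassocAut δ.constField (PetitAlgebra f hf) where
  toFun σ := ⟨
    { toFun x := proj hf (σ.1 (lift x))
      invFun x := proj hf (σ⁻¹.1 (lift x))
      left_inv x := by
        change proj hf (σ⁻¹.1 (lift (proj hf (σ.1 (lift x))))) = x
        rw [lift_proj_map_lift σ.2]
        exact (congrArg (proj hf) (σ.1.symm_apply_apply _)).trans (proj_lift x)
      right_inv x := by
        change proj hf (σ.1 (lift (proj hf (σ⁻¹.1 (lift x))))) = x
        rw [lift_proj_map_lift σ⁻¹.2]
        exact (congrArg (proj hf) (σ.1.apply_symm_apply _)).trans (proj_lift x)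
      map_mul' x y := by
        rw [mul_def, proj_map_lift_proj σ.2, map_mul, mul_def, lift_proj_map_lift σ.2,
          lift_proj_map_lift σ.2]
      map_add' x y := by rw [map_add, map_add, map_add] }, proj_map_lift_smul σ.2⟩
  map_one' := Subtype.ext (RingEquiv.ext proj_lift)
  map_mul' σ τ := Subtype.ext (RingEquiv.ext fun x ↦
    congrArg (fun p ↦ proj hf (σ.1 p)) (lift_proj_map_lift τ.2 x).symm)

theorem inducedAut_injective (hf2 : 2 ≤ f.natDegree) : Function.Injective (inducedAut hf) := by
  refine (injective_iff_map_eq_one _).mpr fun σ hσ ↦ Subtype.ext (RingEquiv.ext fun p ↦ ?_)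
  have fixed {p : DiffPoly δ} (hp : p.natDegree < f.natDegree) : σ.1 p = p := by
    have hproj : proj hf (σ.1 (lift (proj hf p))) = proj hf p :=
      RingEquiv.congr_fun (congrArg Subtype.val hσ) (proj hf p)
    rw [← lift_proj (hf := hf) hp, ← lift_proj_map_lift σ.2, hproj]
  induction p using induction_on with
  | const a => exact fixed (by rw [natDegree_const]; lia)
  | t => exact fixed (Polynomial.natDegree_X.trans_lt hf2)
  | add p q hp hq => rw [map_add, hp, hq, map_add]
  | mul p q hp hq => rw [map_mul, hp, hq, map_mul]

end Automorphisms

end PetitAlgebra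

namespace RingDerivation

variable {D : Type*} [DivisionRing D] (δ : RingDerivation D)

theorem onCenter_mul (u v : Subring.center D) :
    δ.onCenter (u * v) = u * δ.onCenter v + δ.onCenter u * v :=
  Subtype.ext (δ.leibniz u v)

/-- The restriction `δ|_C` as a derivation of the centre `C` over the field of central constants. -/
def centerDerivation : Derivation δ.constField (Subring.center D) (Subring.center D) :=
  Derivation.mk' δ.onCenter fun u v ↦ by
    rw [onCenter_mul, smul_eq_mul, smul_eq_mul, mul_comm (δ.onCenter u)]

theorem finrank_center : Module.finrank δ.constField (Subring.center D) =
    (minpoly δ.constField (δ.onCenter : Module.End δ.constField (Subring.center D))).natDegree :=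
  finrank_eq_natDegree_minpoly_derivation (D := δ.centerDerivation)
    fun x hx ↦ ⟨⟨x, congrArg Subtype.val hx⟩, rfl⟩

variable {δ} in
open Polynomial in
theorem onCenter_pow_three {c : δ.constField}
    (hδ : minpoly δ.constField (δ.onCenter : Module.End δ.constField (Subring.center D)) =
      X ^ 3 - C c * X) (x : Subring.center D) :
    δ (δ (δ x)) = c * δ x := by
  have haeval := minpoly.aeval δ.constField
    (δ.onCenter : Module.End δ.constField (Subring.center D))
  rw [hδ, map_sub, map_pow, map_mul, aeval_X, aeval_C, sub_eq_zero] at haeval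
  exact congrArg Subtype.val (LinearMap.congr_fun haeval x)

/-- The logarithmic derivative `u ↦ δ(u)/u` on the nonzero elements of the centre. -/
noncomputable def logDeriv : (Subring.center D)ˣ →* Multiplicative δ.logDerivatives where
  toFun u := .ofAdd ⟨δ.onCenter u / u, u, u.ne_zero, rfl⟩
  map_one' := Subtype.ext <| show δ.onCenter 1 / 1 = 0 by
    rw [div_one]
    exact Subtype.ext δ.map_one_eq_zero
  map_mul' u v := Subtype.ext <|
    show δ.onCenter (u * v) / (u * v) = δ.onCenter u / u + δ.onCenter v / v by
      rw [onCenter_mul, div_add_div _ _ u.ne_zero v.ne_zero, add_comm]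

theorem logDeriv_surjective : Function.Surjective δ.logDeriv := by
  rintro ⟨_, u, hu, rfl⟩
  exact ⟨Units.mk0 u hu, rfl⟩

theorem logDeriv_eq_one_iff {u : (Subring.center D)ˣ} :
    δ.logDeriv u = 1 ↔ δ (u : Subring.center D) = 0 :=
  Subtype.ext_iff.trans <| div_eq_zero_iff.trans <| (or_iff_left u.ne_zero).trans Subtype.ext_iff

end RingDerivation

namespace PetitAlgebra

open DiffPoly

variable {D : Type*} [DivisionRing D] {δ : RingDerivation D} {f : DiffPoly δ} {hf : f.Monic}

theorem exists_subgroup_equiv_logDerivatives (hf2 : 2 ≤ f.natDegree)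
    (hfix : ∀ u : Dˣ, (u : D) ∈ Subring.center D → conj u ∈ fixingAut f) :
    ∃ H : Subgroup (nonassocAut δ.constField (PetitAlgebra f hf)),
      Nonempty (Multiplicative δ.logDerivatives ≃* H) := by
  let toUnits : (Subring.center D)ˣ →* Dˣ := Units.map (Subring.center D).subtype.toMonoidHom
  let conjAut : (Subring.center D)ˣ →* nonassocAut δ.constField (PetitAlgebra f hf) :=
    (inducedAut hf).comp ((conj.comp toUnits).codRestrict (fixingAut f)
      fun u ↦ hfix (toUnits u) (u : Subring.center D).2)
  have hker : δ.logDeriv.ker = conjAut.ker := by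
    ext u
    have hconj : conjAut u = 1 ↔ (conj (toUnits u) : RingAut (DiffPoly δ)) = 1 :=
      (map_eq_one_iff (inducedAut hf) (inducedAut_injective hf2)).trans Subtype.ext_iff
    rw [MonoidHom.mem_ker, MonoidHom.mem_ker, hconj, DiffPoly.conj_eq_one_iff,
      δ.logDeriv_eq_one_iff]
    exact (and_iff_right (u : Subring.center D).2).symm
  exact ⟨conjAut.range,
    ⟨(QuotientGroup.quotientKerEquivOfSurjective _ δ.logDeriv_surjective).symm.trans
      ((QuotientGroup.quotientMulEquivOfEq hker).trans
        (QuotientGroup.quotientKerEquivRange conjAut))⟩⟩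

end PetitAlgebra

theorem mainTheorem7 {D : Type*} [DivisionRing D] [CharP D 3]
    [FiniteDimensional (Subring.center D) D]
    (n : ℕ) (hn : Module.finrank (Subring.center D) D = n ^ 2)
    (δ : RingDerivation D) (c : δ.constField)
    (hδ : minpoly δ.constField (δ.onCenter : Module.End δ.constField (Subring.center D))
      = Polynomial.X ^ 3 - Polynomial.C c * Polynomial.X)
    (d : D) :
    -- `(D, δ, d)` is an `F`-algebra of dimension `9n²` (it is unital by its ring structure)
    (IsScalarTower δ.constField (GenDiffAlgebra δ c d) (GenDiffAlgebra δ c d) ∧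
      SMulCommClass δ.constField (GenDiffAlgebra δ c d) (GenDiffAlgebra δ c d) ∧
      Module.finrank δ.constField (GenDiffAlgebra δ c d) = 9 * n ^ 2) ∧
    -- the division criterion
    (IsNonassocDivision (GenDiffAlgebra δ c d) ↔
      ∀ z : D, DiffPoly.V δ 3 z - c * z ≠ d ∧ DiffPoly.V δ 3 z - z * c - d + δ c ≠ 0) ∧
    -- the associativity criterion, when `g(δ) = 0` on the whole of `D`
    ((∀ x : D, δ (δ (δ x)) = c * δ x) →
      ((∀ x y z : GenDiffAlgebra δ c d, x * y * z = x * (y * z)) ↔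
        ∃ a : δ.constField, ((a : Subring.center D) : D) = d)) ∧
    -- the automorphism group
    (∃ H : Subgroup (nonassocAut δ.constField (GenDiffAlgebra δ c d)),
      Nonempty (Multiplicative δ.logDerivatives ≃* H)) := by
  have hC : Module.finrank δ.constField (Subring.center D) = 3 := by
    rw [δ.finrank_center, hδ]
    compute_degree!
  have : FiniteDimensional δ.constField (Subring.center D) :=
    Module.finite_of_finrank_pos (by lia)
  have : FiniteDimensional δ.constField D := Module.Finite.trans (Subring.center D) D
  have hD : Module.finrank δ.constField D = 3 * n ^ 2 := by
    rw [← Module.finrank_mul_finrank δ.constField (Subring.center D) D, hC, hn]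
  have hf : (cubicPoly δ c d).natDegree = 3 := DiffPoly.natDegree_cubicPoly _ _
  refine ⟨⟨inferInstance, inferInstance, ?_⟩, ?_, fun hδD ↦ ?_, ?_⟩
  · rw [PetitAlgebra.finrank_eq_natDegree_mul, hf, hD]
    ring
  · exact PetitAlgebra.isNonassocDivision_iff_irreducible.trans
      (DiffPoly.irreducible_cubicPoly_iff _ _)
  · exact (PetitAlgebra.mul_assoc_iff_isTwoSided (hf ▸ Nat.le_succ 2)).trans
      (DiffPoly.isTwoSided_span_cubicPoly_iff_of_forall c d hδD)
  · exact PetitAlgebra.exists_subgroup_equiv_logDerivatives (hf ▸ Nat.le_succ 2) fun u hu ↦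
      DiffPoly.conj_mem_fixingAut_cubicPoly c d hu (RingDerivation.onCenter_pow_three hδ ⟨u, hu⟩)
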